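/- Let $V$ be a complex vector space with a basis $(b_1,\dots,b_N)$, where $N\in\mathbb{Z}_{\ge 0}$, let $\mathfrak{gl}_N=\operatorname{End}(V)$, and let $E_{i,j}\in\mathfrak{gl}_N$ be the matrix units, $E_{i,j}b_j=b_i$. The algebra $U(\mathfrak{gl}_N)$ acts on $V^{\otimes n}$, where $n\in\mathbb{Z}_{\ge 0}$, by $g\mapsto g_1+\dots+g_n$ for $g\in\mathfrak{gl}_N$, where $g_k$ acts as $g$ on the $k$-th factor and trivially on the others. Let $\mathrm{P}_{i,j}$ be the operator on $V^{\otimes n}$ that exchanges the $i$-th and $j$-th factors, and consider the rational function, associated with the Yang solution $R(u)=\mathrm{Id}-\mathrm{P}/u$, $$F(u_1,\dots,u_n)=\prod_{1\le i<j\le n}^{\rightarrow}\Bigl(\mathrm{Id}-\frac{\mathrm{P}_{i,j}}{u_i-u_j}\Bigr)\in\operatorname{End}(V^{\otimes n}),$$ where the factors are ordered lexicographically in $(i,j)$ from left to right (the empty product is $\mathrm{Id}$). Let $\lambda$ be a partition of $n$ with at most $N$ parts, and let $\mathcal{T}$ be a standard Young tableau of shape $\lambda$. For $k=1,\dots,n$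 let $\mathrm{cc}_k$ be the column number minus the row number of the node of $\mathcal{T}$ that contains $k$. Put $\lambda_i=0$ if $i$ exceeds the number of parts, and let $M_\lambda$ be the irreducible highest-weight $U(\mathfrak{gl}_N)$-module of highest weight $\lambda$, that is, the quotient by its largest proper submodule of the Verma module $U(\mathfrak{gl}_N)/J_\lambda$, where $J_\lambda$ is the left ideal generated by the $E_{i,j}$ with $i<j$ and the $E_{i,i}-\lambda_i$, $1\le i\le N$. Then the consecutive evaluations $$F(\mathcal{T}):=F(u_1,\dots,u_n)\big|_{u_1=\mathrm{cc}_1}\big|_{u_2=\mathrm{cc}_2}\cdots\big|_{u_n=\mathrm{cc}_n}$$ are well defined: at each step, the rational function obtained so far is non-singular along the hyperplane $u_k=\mathrm{cc}_k$ (it is of the form $p/q$ with an operator-valued polynomial $p$ and a scalar polynomial $q$ that does not vanish identically on $u_k=\mathrm{cc}_k$) and is restricted to it. The image $W_{\mathcal{T}}\subset V^{\otimes n}$ of the operator $F(\mathcal{T})$ is a $U(\mathfrak{gl}_N)$-submodule of $V^{\otimes n}$; it is irreducible and isomorphic to $M_\lambda$. -/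

import Mathlib

open scoped TensorProduct

noncomputable section

namespace FusedYang

/-! ### Standard Young tableaux -/

/-- A standard Young tableau with `n` entries, of shape the Young diagram `μ`: a bijection from
the entries (here `0, …, n - 1` instead of `1, …, n`) to the nodes `(row, column)` of `μ`, such
that the entries increase along rows and down columns. -/
structure StandardYoungTableau (n : ℕ) (μ : YoungDiagram) where
  /-- The node which contains a given entry. -/
  node : Fin n ≃ {x : ℕ × ℕ // x ∈ μ.cells}
  /-- A node which lies weakly below and weakly to the right of another node contains the
  larger number. -/
  standard : ∀ i j : Fin n, (node i).1.1 ≤ (node j).1.1 → (node i).1.2 ≤ (node j).1.2 → i ≤ j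

/-- The classical content (column minus row) of the node that contains the entry `i`. -/
def StandardYoungTableau.content {n : ℕ} {μ : YoungDiagram} (T : StandardYoungTableau n μ)
    (i : Fin n) : ℂ :=
  ((T.node i).1.2 : ℂ) - ((T.node i).1.1 : ℂ)

/-! ### Operator-valued rational functions and their consecutive evaluations -/

/-- Polynomials in the variables `u_0, …, u_{n-1}`. -/
abbrev Poly (n : ℕ) : Type := MvPolynomial (Fin n) ℂ

/-- Rational functions in the variables `u_0, …, u_{n-1}`. -/
abbrev RatFn (n : ℕ) : Type := FractionRing (MvPolynomial (Fin n) ℂ)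

section Evaluation

variable {n : ℕ} {A : Type*} [Ring A] [Algebra ℂ A]

/-- The variable `u_i`, as a rational function. -/
def ratVar (i : Fin n) : RatFn n := algebraMap (Poly n) (RatFn n) (MvPolynomial.X i)

/-- The substitution `u_k = a` in polynomials; the other variables are kept. -/
def substPoly (k : Fin n) (a : ℂ) : Poly n →ₐ[ℂ] Poly n :=
  MvPolynomial.aeval (Function.update MvPolynomial.X k (MvPolynomial.C a))

/-- An `A`-valued polynomial, seen as an `A`-valued rational function. -/
def polyToRat : Poly n ⊗[ℂ] A →ₐ[ℂ] RatFn n ⊗[ℂ] A :=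
  Algebra.TensorProduct.map (IsScalarTower.toAlgHom ℂ (Poly n) (RatFn n)) (AlgHom.id ℂ A)

/-- The substitution `u_k = a` in `A`-valued polynomials. -/
def substPolyVal (k : Fin n) (a : ℂ) : Poly n ⊗[ℂ] A →ₐ[ℂ] Poly n ⊗[ℂ] A :=
  Algebra.TensorProduct.map (substPoly k a) (AlgHom.id ℂ A)

/-- The `A`-valued rational function `f` is non-singular along the hyperplane `u_k = a`, and `g` is
its restriction `f|_{u_k = a}`: one can write `f = p / q`, where `p` is an `A`-valued polynomial and
`q` is a polynomial that does not vanish identically on `u_k = a`, and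
`g = p|_{u_k = a} / q|_{u_k = a}`. -/
def IsEvalAt (k : Fin n) (a : ℂ) (f g : RatFn n ⊗[ℂ] A) : Prop :=
  ∃ (q : Poly n) (p : Poly n ⊗[ℂ] A), substPoly k a q ≠ 0 ∧
    algebraMap (Poly n) (RatFn n) q • f = polyToRat p ∧
    algebraMap (Poly n) (RatFn n) (substPoly k a q) • g = polyToRat (substPolyVal k a p)

/-- `x : A` is the result of the consecutive evaluations
`f |_{u_0 = a 0} |_{u_1 = a 1} … |_{u_{n-1} = a (n-1)}` (in this order), each of which is taken of
a function that is non-singular along the hyperplane in question. -/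
def IsConsecutiveEval (f : RatFn n ⊗[ℂ] A) (a : Fin n → ℂ) (x : A) : Prop :=
  ∃ G : Fin (n + 1) → RatFn n ⊗[ℂ] A,
    G 0 = f ∧ (∀ k : Fin n, IsEvalAt k (a k) (G k.castSucc) (G k.succ)) ∧
      G (Fin.last n) = 1 ⊗ₜ[ℂ] x

end Evaluation

/-! ### The operator `F` of the Yang solution -/

section Operators

variable (n : ℕ) (V : Type*) [AddCommGroup V] [Module ℂ V]

/-- The tensor power `V^{⊗ n}`. -/
abbrev TPow : Type _ := ⨂[ℂ] _ : Fin n, V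

variable {n}

/-- The operator `P_{i,j}` on `V^{⊗ n}` that exchanges the `i`-th and `j`-th tensor factors. -/
def permOp (i j : Fin n) : Module.End ℂ (TPow n V) :=
  (PiTensorProduct.reindex ℂ (fun _ : Fin n => V) (Equiv.swap i j)).toLinearMap

/-- The operator `R_{i,j}(u_i - u_j) = Id - P_{i,j} / (u_i - u_j)`, as a rational function of
`u_0, …, u_{n-1}` with values in `End (V^{⊗ n})`; here `R(u) = Id - P / u`. -/
def yangFactor (i j : Fin n) : RatFn n ⊗[ℂ] Module.End ℂ (TPow n V) :=
  1 - (ratVar i - ratVar j)⁻¹ ⊗ₜ[ℂ] permOp V i j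

variable (n)

/-- The rational function `F = ∏_{i < j} R_{i,j}(u_i - u_j)` with values in `End (V^{⊗ n})`, the
factors being ordered lexicographically in `(i, j)`, from left to right. -/
def fusionF : RatFn n ⊗[ℂ] Module.End ℂ (TPow n V) :=
  ((List.finRange n).flatMap fun i =>
    ((List.finRange n).filter fun j => i < j).map fun j => yangFactor V i j).prod

end Operators

/-! ### The action of `U(gl_N)` on `V^{⊗ n}` -/

section Action

attribute [local instance] LieRing.ofAssociativeRing

variable (V : Type*) [AddCommGroup V] [Module ℂ V]

/-- The universal enveloping algebra of the Lie algebra `gl(V)` of all endomorphisms of `V`. -/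
abbrev Ugl : Type _ := UniversalEnvelopingAlgebra ℂ (Module.End ℂ V)

variable {V} {n : ℕ}

/-- The operator `g_i` on `V^{⊗ n}`, which acts as `g` on the `i`-th factor and trivially on the
other factors. -/
def onFactor (i : Fin n) (g : Module.End ℂ V) : Module.End ℂ (TPow n V) :=
  PiTensorProduct.map (Function.update (fun _ : Fin n => (LinearMap.id : V →ₗ[ℂ] V)) i g)

theorem onFactor_tprod (i : Fin n) (g : Module.End ℂ V) (x : Fin n → V) :
    onFactor i g (PiTensorProduct.tprod ℂ x) =
      PiTensorProduct.tprod ℂ (Function.update x i (g (x i))) := by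
  rw [onFactor, PiTensorProduct.map_tprod]
  congr 1
  funext j
  by_cases h : j = i
  · subst h; simp
  · simp [h]

theorem onFactor_add (i : Fin n) (g h : Module.End ℂ V) :
    onFactor i (g + h) = onFactor i g + onFactor i h := by
  apply PiTensorProduct.ext
  ext x
  simp [onFactor_tprod]

theorem onFactor_smul (i : Fin n) (c : ℂ) (g : Module.End ℂ V) :
    onFactor i (c • g) = c • onFactor i g := by
  apply PiTensorProduct.ext
  ext x
  simp [onFactor_tprod]

theorem onFactor_sub (i : Fin n) (g h : Module.End ℂ V) :
    onFactor i (g - h) = onFactor i g - onFactor i h := by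
  apply PiTensorProduct.ext
  ext x
  simp [onFactor_tprod]

theorem onFactor_mul (i : Fin n) (g h : Module.End ℂ V) :
    onFactor i (g * h) = onFactor i g * onFactor i h := by
  apply PiTensorProduct.ext
  ext x
  simp [onFactor_tprod]

theorem onFactor_comm {i j : Fin n} (hij : i ≠ j) (g h : Module.End ℂ V) :
    onFactor i g * onFactor j h = onFactor j h * onFactor i g := by
  apply PiTensorProduct.ext
  ext x
  simp [onFactor_tprod, hij, hij.symm, Function.update_comm hij]

variable (n) (V)

/-- The representation `χ` of `gl(V)` on `V^{⊗ n}`: `g` acts as `g_1 + ⋯ + g_n`. -/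
def chiLie : Module.End ℂ V →ₗ⁅ℂ⁆ Module.End ℂ (TPow n V) where
  toFun g := ∑ i, onFactor i g
  map_add' g h := by simp [onFactor_add, Finset.sum_add_distrib]
  map_smul' c g := by simp [onFactor_smul, Finset.smul_sum]
  map_lie' := by
    intro g h
    have hs (i : Fin n) : onFactor i (g * h - h * g) =
        onFactor i g * onFactor i h - onFactor i h * onFactor i g := by
      rw [onFactor_sub, onFactor_mul, onFactor_mul]
    simp only [LieRing.of_associative_ring_bracket, hs, Finset.sum_mul_sum]
    rw [Finset.sum_comm (f := fun i j => onFactor i h * onFactor j g), ← Finset.sum_sub_distrib]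
    refine Finset.sum_congr rfl fun i _ => ?_
    rw [← Finset.sum_sub_distrib, Finset.sum_eq_single i]
    · intro j _ hj
      rw [onFactor_comm hj.symm, sub_self]
    · simp

/-- The extension of `χ` to `U(gl(V))`. -/
def chi : Ugl V →ₐ[ℂ] Module.End ℂ (TPow n V) :=
  UniversalEnvelopingAlgebra.lift ℂ (chiLie V n)

/-- `V^{⊗ n}` as a module over `U(gl(V))`, through `χ`. -/
instance tensorModule : Module (Ugl V) (TPow n V) :=
  Module.compHom (TPow n V) (chi V n).toRingHom

end Action

/-! ### The irreducible highest-weight modules -/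

section HighestWeight

attribute [local instance] LieRing.ofAssociativeRing

variable {V : Type*} [AddCommGroup V] [Module ℂ V] {N : ℕ}

/-- The matrix unit `E_{i,j}` of `gl(V)` in the basis `b`, as an element of `U(gl(V))`: it sends
`b j` to `b i` and the other basis vectors to `0`. -/
def matUnit (b : Module.Basis (Fin N) ℂ V) (i j : Fin N) : Ugl V :=
  UniversalEnvelopingAlgebra.ι ℂ (Matrix.toLin b b (Matrix.single i j 1))

/-- The left ideal of `U(gl(V))` generated by `E_{i,j}`, for `i < j`, and by `E_{i,i} - w i`. -/
def vermaIdeal (b : Module.Basis (Fin N) ℂ V) (w : Fin N → ℂ) : Submodule (Ugl V) (Ugl V) :=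
  Submodule.span (Ugl V)
    ({x | ∃ i j, i < j ∧ x = matUnit b i j} ∪
      {x | ∃ i, x = matUnit b i i - algebraMap ℂ (Ugl V) (w i)})

/-- The Verma module of highest weight `w`. -/
abbrev Verma (b : Module.Basis (Fin N) ℂ V) (w : Fin N → ℂ) : Type _ :=
  Ugl V ⧸ vermaIdeal b w

/-- The irreducible highest-weight module of highest weight `w`: the quotient of the Verma module
by its largest proper submodule, the sum of all its proper submodules. -/
abbrev HighestWeightModule (b : Module.Basis (Fin N) ℂ V) (w : Fin N → ℂ) : Type _ :=
  Verma b w ⧸ sSup {S : Submodule (Ugl V) (Verma b w) | S ≠ ⊤}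

end HighestWeight

end FusedYang

end

/-! The product `F` is the image of an element `symF` of the group algebra of the symmetric group
over the rational functions. Factors with nested index pairs commute, so `F` is also the product
over `j` of the columns of factors `(i, j)`, `i < j`. Let `r` be the row word of the tableau and `c
k` the contents. When the first `k` variables have been evaluated, the first `k` columns have become
an element `F_k` (`fused`). The later columns still contain their own free variable, so only column
`k` can be singular at `u_k = c k`.

This singularity is controlled by the Jucys–Murphy element `J_k`. By `fusion_identity`, `F_k (u -
J_k)` times column `k` is a scalar multiple of `F_k`, and by `fusion_factor` the scalar telescopes
to `(u + M) ∏ (u - d_i) / (u - d_i + 1)`, where `d_i` is the content of the next node in row `i <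
M`. If `∏ (J_k - d_i) F_k = 0`, then decomposing by the Lagrange projectors of `J_k` cancels the
pole: the summand of row `i` keeps the numerator `∏_{j ≠ i} (u - d_j)`. At `u = d_{r k} = c k` only
row `r k` survives, and `F_{k+1}` is a multiple of the projection of `F_k` to that eigenvalue.

The vanishing `∏ (J_k - d_i) F_k = 0` (`nodalVanishing`) comes from the commuting action of `gl_M`
on words in `M` letters, `M ≥ n`, where the group algebra acts faithfully. There `J_k` is the split
Casimir operator, and on the component of a singular vector with the largest last letter `j` it acts
as `E_{j,j} - j` in the first `k` factors. Inductively, singular vectors in the image of `F_k` have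
as weight the row lengths after `k` nodes, so this value is `d_j`; hence the product kills singular
vectors, and self-adjointness of `J_k` extends this to the whole image.

The same top components show that a singular vector in the image of `F_n` is determined by one
coefficient, the one at the word `r`. A nonzero submodule and its nonzero orthogonal complement
would both contain a singular vector, so the image is irreducible, with highest weight `λ`. It is
nonzero because the coefficient of the identity permutation in `symF` is `1`, which evaluation
preserves; a weight argument transfers this from `M` letters to `N`. Finally, a simple module with a
highest-weight vector is the quotient of the Verma module by its largest proper submodule. -/

noncomputable section

namespace FusedYang

/-! ### Calculus of the evaluations of operator-valued rational functions -/

section EvaluationLemmas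

variable {n : ℕ} {A B : Type*} [Ring A] [Algebra ℂ A] [Ring B] [Algebra ℂ B]

theorem polyToRat_injective : Function.Injective (polyToRat : Poly n ⊗[ℂ] A →ₐ[ℂ] RatFn n ⊗[ℂ] A) := by
  have h : Function.Injective (IsScalarTower.toAlgHom ℂ (Poly n) (RatFn n)).toLinearMap :=
    IsFractionRing.injective (Poly n) (RatFn n)
  exact Module.Flat.rTensor_preserves_injective_linearMap (M := A) _ h

theorem polyToRat_smul (q : Poly n) (p : Poly n ⊗[ℂ] A) :
    polyToRat (q • p) = algebraMap (Poly n) (RatFn n) q • polyToRat p := by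
  induction p with
  | zero => simp
  | tmul x y => simp [polyToRat, TensorProduct.smul_tmul', Algebra.smul_def]
  | add x y hx hy => simp only [smul_add, map_add, hx, hy]

theorem substPolyVal_smul (k : Fin n) (a : ℂ) (q : Poly n) (p : Poly n ⊗[ℂ] A) :
    substPolyVal k a (q • p) = substPoly k a q • substPolyVal k a p := by
  induction p with
  | zero => simp
  | tmul x y => simp [substPolyVal, TensorProduct.smul_tmul']
  | add x y hx hy => simp only [smul_add, map_add, hx, hy]

/-- Cross-multiplying two presentations gives an identity of polynomials, which may be specialised;
both denominators survive the specialisation and can be cancelled. -/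
theorem IsEvalAt.unique {k : Fin n} {a : ℂ} {f g g' : RatFn n ⊗[ℂ] A}
    (h : IsEvalAt k a f g) (h' : IsEvalAt k a f g') : g = g' := by
  obtain ⟨q, p, hq, hf, hg⟩ := h
  obtain ⟨q', p', hq', hf', hg'⟩ := h'
  have h1 : q' • p = q • p' := by
    apply polyToRat_injective
    rw [polyToRat_smul, polyToRat_smul, ← hf, ← hf', smul_comm]
  have h2 := congrArg (fun z => polyToRat (substPolyVal k a z)) h1
  simp only [substPolyVal_smul, polyToRat_smul, ← hg, ← hg'] at h2
  rw [smul_comm, ← smul_assoc, ← smul_assoc] at h2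
  have h3 : algebraMap (Poly n) (RatFn n) (substPoly k a q) *
      algebraMap (Poly n) (RatFn n) (substPoly k a q') ≠ 0 :=
    mul_ne_zero (by simpa using hq) (by simpa using hq')
  exact smul_right_injective _ h3 (by simpa [smul_eq_mul] using h2)

theorem IsEvalAt.mul {k : Fin n} {a : ℂ} {f g f' g' : RatFn n ⊗[ℂ] A}
    (h : IsEvalAt k a f g) (h' : IsEvalAt k a f' g') : IsEvalAt k a (f * f') (g * g') := by
  obtain ⟨q, p, hq, hf, hg⟩ := h
  obtain ⟨q', p', hq', hf', hg'⟩ := h'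
  refine ⟨q * q', p * p', by simpa using ⟨hq, hq'⟩, ?_, ?_⟩
  · rw [map_mul, map_mul, ← hf, ← hf', smul_mul_smul_comm]
  · rw [map_mul, map_mul, map_mul, map_mul, ← hg, ← hg', smul_mul_smul_comm]

theorem IsEvalAt.add {k : Fin n} {a : ℂ} {f g f' g' : RatFn n ⊗[ℂ] A}
    (h : IsEvalAt k a f g) (h' : IsEvalAt k a f' g') : IsEvalAt k a (f + f') (g + g') := by
  obtain ⟨q, p, hq, hf, hg⟩ := h
  obtain ⟨q', p', hq', hf', hg'⟩ := h'
  refine ⟨q * q', q' • p + q • p', by simpa using ⟨hq, hq'⟩, ?_, ?_⟩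
  · rw [map_add, polyToRat_smul, polyToRat_smul, ← hf, ← hf', map_mul, smul_add, mul_smul,
      mul_smul, smul_comm]
  · rw [map_add, map_add, substPolyVal_smul, substPolyVal_smul, polyToRat_smul, polyToRat_smul,
      ← hg, ← hg', map_mul, map_mul, smul_add, mul_smul, mul_smul, smul_comm]

theorem isEvalAt_const (k : Fin n) (a : ℂ) (x : A) :
    IsEvalAt k a ((1 : RatFn n) ⊗ₜ[ℂ] x) ((1 : RatFn n) ⊗ₜ[ℂ] x) :=
  ⟨1, 1 ⊗ₜ x, by simp, by simp [polyToRat], by simp [polyToRat, substPolyVal]⟩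

theorem isEvalAt_tmul {k : Fin n} {a : ℂ} {q p : Poly n} {v w : RatFn n}
    (hq : substPoly k a q ≠ 0) (hv : algebraMap (Poly n) (RatFn n) q * v = algebraMap _ _ p)
    (hw : algebraMap (Poly n) (RatFn n) (substPoly k a q) * w =
      algebraMap _ _ (substPoly k a p)) (x : A) :
    IsEvalAt k a (v ⊗ₜ[ℂ] x) (w ⊗ₜ[ℂ] x) := by
  refine ⟨q, p ⊗ₜ x, hq, ?_, ?_⟩
  · rw [TensorProduct.smul_tmul', smul_eq_mul, hv]
    simp [polyToRat]
  · rw [TensorProduct.smul_tmul', smul_eq_mul, hw]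
    simp [polyToRat, substPolyVal]

theorem isEvalAt_zero (k : Fin n) (a : ℂ) :
    IsEvalAt k a (0 : RatFn n ⊗[ℂ] A) (0 : RatFn n ⊗[ℂ] A) := by
  simpa using isEvalAt_const k a (0 : A)

theorem isEvalAt_one (k : Fin n) (a : ℂ) :
    IsEvalAt k a (1 : RatFn n ⊗[ℂ] A) (1 : RatFn n ⊗[ℂ] A) := isEvalAt_const k a (1 : A)

theorem IsEvalAt.sum {ι : Type*} {k : Fin n} {a : ℂ} {f g : ι → RatFn n ⊗[ℂ] A} (s : Finset ι)
    (h : ∀ i ∈ s, IsEvalAt k a (f i) (g i)) : IsEvalAt k a (∑ i ∈ s, f i) (∑ i ∈ s, g i) := by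
  classical
  induction s using Finset.induction_on with
  | empty => simpa using isEvalAt_zero k a
  | insert i s hi ih =>
    rw [Finset.sum_insert hi, Finset.sum_insert hi]
    exact (h i (by simp)).add (ih fun j hj => h j (by simp [hj]))

theorem IsEvalAt.list_prod {ι : Type*} {k : Fin n} {a : ℂ} {f g : ι → RatFn n ⊗[ℂ] A} (l : List ι)
    (h : ∀ i ∈ l, IsEvalAt k a (f i) (g i)) :
    IsEvalAt k a (l.map f).prod (l.map g).prod := by
  induction l with
  | nil => simpa using isEvalAt_one k a
  | cons i l ih =>
    simp only [List.map_cons, List.prod_cons]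
    exact (h i (by simp)).mul (ih fun j hj => h j (by simp [hj]))

/-- Extension of scalars to rational functions of a linear map. -/
def ratMap (φ : A →ₗ[ℂ] B) : RatFn n ⊗[ℂ] A →ₗ[RatFn n] RatFn n ⊗[ℂ] B :=
  TensorProduct.AlgebraTensorModule.map LinearMap.id φ

@[simp] theorem ratMap_tmul (φ : A →ₗ[ℂ] B) (x : RatFn n) (y : A) :
    ratMap φ (x ⊗ₜ[ℂ] y) = x ⊗ₜ[ℂ] φ y := rfl

/-- Linearity of `φ` suffices. This covers both the passage from the group algebra to operators and
the extraction of a single coefficient. -/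
theorem IsEvalAt.map {k : Fin n} {a : ℂ} {f g : RatFn n ⊗[ℂ] A} (φ : A →ₗ[ℂ] B)
    (h : IsEvalAt k a f g) : IsEvalAt k a (ratMap φ f) (ratMap φ g) := by
  obtain ⟨q, p, hq, hf, hg⟩ := h
  have h1 (z : Poly n ⊗[ℂ] A) :
      ratMap φ (polyToRat z) = polyToRat (LinearMap.lTensor (Poly n) φ z) := by
    induction z with
    | zero => simp
    | tmul x y => simp [polyToRat]
    | add x y hx hy => simp only [map_add, hx, hy]
  have h2 (z : Poly n ⊗[ℂ] A) : LinearMap.lTensor (Poly n) φ (substPolyVal k a z) =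
      substPolyVal k a (LinearMap.lTensor (Poly n) φ z) := by
    induction z with
    | zero => simp
    | tmul x y => simp [substPolyVal]
    | add x y hx hy => simp only [map_add, hx, hy]
  refine ⟨q, LinearMap.lTensor (Poly n) φ p, hq, ?_, ?_⟩
  · rw [← h1, ← hf, map_smul]
  · rw [← h2, ← h1, ← hg, map_smul]

theorem one_tmul_injective : Function.Injective fun x : A => (1 : RatFn n) ⊗ₜ[ℂ] x :=
  Algebra.TensorProduct.includeRight_injective (FaithfulSMul.algebraMap_injective ℂ (RatFn n))

theorem IsConsecutiveEval.unique {f : RatFn n ⊗[ℂ] A} {a : Fin n → ℂ} {x y : A}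
    (hx : IsConsecutiveEval f a x) (hy : IsConsecutiveEval f a y) : x = y := by
  obtain ⟨G, h0, hs, hl⟩ := hx
  obtain ⟨G', h0', hs', hl'⟩ := hy
  have key : ∀ k, G k = G' k := by
    intro k
    induction k using Fin.induction with
    | zero => rw [h0, h0']
    | succ k ih =>
      have := hs' k
      rw [← ih] at this
      exact (hs k).unique this
  apply one_tmul_injective (n := n)
  simp only [← hl, ← hl', key]

theorem IsConsecutiveEval.map {f : RatFn n ⊗[ℂ] A} {a : Fin n → ℂ} {x : A} (φ : A →ₗ[ℂ] B)
    (hx : IsConsecutiveEval f a x) : IsConsecutiveEval (ratMap φ f) a (φ x) := by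
  obtain ⟨G, h0, hs, hl⟩ := hx
  exact ⟨fun k => ratMap φ (G k), by simp [h0], fun k => (hs k).map φ, by simp [hl]⟩

theorem isConsecutiveEval_const (a : Fin n → ℂ) (x : A) :
    IsConsecutiveEval ((1 : RatFn n) ⊗ₜ[ℂ] x) a x :=
  ⟨fun _ => 1 ⊗ₜ x, rfl, fun k => isEvalAt_const k _ x, rfl⟩

end EvaluationLemmas

/-! ### Reordering noncommutative products -/

section Products

variable {ι κ R : Type*} [Monoid R]

theorem commute_list_prod {l : List ι} {f : ι → R} {x : R} (h : ∀ i ∈ l, Commute x (f i)) :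
    Commute x (l.map f).prod := by
  induction l with
  | nil => simp
  | cons i l ih =>
    simp only [List.map_cons, List.prod_cons]
    exact (h i (by simp)).mul_right (ih fun j hj => h j (by simp [hj]))

theorem list_prod_map_mul {l : List ι} {f g : ι → R}
    (h : l.Pairwise fun i j => Commute (f j) (g i)) :
    (l.map f).prod * (l.map g).prod = (l.map fun i => f i * g i).prod := by
  induction l with
  | nil => simp
  | cons i l ih =>
    rw [List.pairwise_cons] at h
    have hc : Commute (g i) (l.map f).prod := commute_list_prod fun j hj => (h.1 j hj).symm
    simp only [List.map_cons, List.prod_cons]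
    rw [← ih h.2, mul_assoc, ← mul_assoc _ (g i), ← hc.eq]
    simp only [mul_assoc]

/-- The pairs whose relative order differs between the row-wise and the column-wise product are
exactly the `(i, j')` and `(i', j)` with `i` before `i'` and `j` before `j'`. -/
theorem list_prod_comm {l : List ι} {m : List κ} {f : ι → κ → R}
    (h : l.Pairwise fun i i' => m.Pairwise fun j j' => Commute (f i j') (f i' j)) :
    (l.map fun i => (m.map fun j => f i j).prod).prod =
      (m.map fun j => (l.map fun i => f i j).prod).prod := by
  induction l with
  | nil => simp
  | cons i l ih =>
    rw [List.pairwise_cons] at h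
    simp only [List.map_cons, List.prod_cons]
    rw [ih h.2, list_prod_map_mul]
    refine List.pairwise_iff_forall_sublist.mpr fun {j j'} hj => commute_list_prod fun i' hi' => ?_
    exact List.pairwise_iff_forall_sublist.mp (h.1 i' hi') hj

theorem list_prod_filter (l : List ι) (p : ι → Prop) [DecidablePred p] (f : ι → R) :
    ((l.filter p).map f).prod = (l.map fun i => if p i then f i else 1).prod := by
  induction l with
  | nil => simp
  | cons i l ih =>
    by_cases hi : p i <;> simp [hi, ih]

theorem list_prod_flatMap (l : List ι) (f : ι → List R) :
    (l.flatMap f).prod = (l.map fun i => (f i).prod).prod := by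
  induction l with
  | nil => simp
  | cons i l ih => simp [ih]

/-- The lexicographic product over the pairs `i < j` agrees with the colexicographic one, as soon
as factors with disjoint pairs of indices commute. -/
theorem lex_prod_eq_colex_prod {n : ℕ} (f : Fin n → Fin n → R)
    (h : ∀ i k l j : Fin n, i < k → k < l → l < j → Commute (f i j) (f k l)) :
    ((List.finRange n).flatMap fun i =>
      ((List.finRange n).filter fun j => i < j).map fun j => f i j).prod =
    ((List.finRange n).map fun j =>
      (((List.finRange n).filter fun i => i < j).map fun i => f i j).prod).prod := by
  rw [list_prod_flatMap]
  simp only [list_prod_filter]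
  refine list_prod_comm ?_
  have hp : (List.finRange n).Pairwise (· < ·) := List.pairwise_lt_finRange n
  refine hp.imp fun {i i'} hi => hp.imp fun {j j'} hj => ?_
  -- The factor at `(i', j)` is trivial unless `i' < j`, and then the two pairs are nested: `i < i'
  -- < j < j'`.
  by_cases h1 : i' < j
  · rw [if_pos (hi.trans (h1.trans hj)), if_pos h1]
    exact h i i' j j' hi h1 hj
  · simp [h1]

theorem filter_lt_succ {n : ℕ} (k : Fin n) :
    (List.finRange n).filter (fun i : Fin n => (i : ℕ) < k + 1) =
      (List.finRange n).filter (fun i : Fin n => (i : ℕ) < k) ++ [k] := by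
  have key : ∀ l : List (Fin n), l.Pairwise (· < ·) → k ∈ l →
      l.filter (fun i : Fin n => (i : ℕ) < k + 1) = l.filter (fun i : Fin n => (i : ℕ) < k) ++ [k] := by
    intro l
    induction l with
    | nil => simp
    | cons i l ih =>
      intro hp hk
      rw [List.pairwise_cons] at hp
      rcases List.mem_cons.mp hk with rfl | hk
      · have h1 : l.filter (fun i : Fin n => (i : ℕ) < k + 1) = [] := by
          simp only [List.filter_eq_nil_iff, decide_eq_true_eq]
          intro j hj; have := hp.1 j hj; omega
        have h2 : l.filter (fun i : Fin n => (i : ℕ) < k) = [] := by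
          simp only [List.filter_eq_nil_iff, decide_eq_true_eq]
          intro j hj; have := hp.1 j hj; omega
        rw [List.filter_cons_of_pos (by simp), List.filter_cons_of_neg (by simp), h1, h2]
        rfl
      · have := hp.1 k hk
        have h1 : (i : ℕ) < k := this
        have h2 : (i : ℕ) < k + 1 := by omega
        rw [List.filter_cons_of_pos (by simp only [decide_eq_true_eq]; exact h2),
          List.filter_cons_of_pos (by simp only [decide_eq_true_eq]; exact h1), ih hp.2 hk]
        rfl
  exact key _ (List.pairwise_lt_finRange n) (List.mem_finRange k)

theorem filter_le_eq_cons {n : ℕ} (k : Fin n) :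
    (List.finRange n).filter (fun i : Fin n => (k : ℕ) ≤ i) =
      k :: (List.finRange n).filter (fun i : Fin n => (k : ℕ) + 1 ≤ i) := by
  have key : ∀ l : List (Fin n), l.Pairwise (· < ·) → k ∈ l →
      l.filter (fun i : Fin n => (k : ℕ) ≤ i) = k :: l.filter (fun i : Fin n => (k : ℕ) + 1 ≤ i) := by
    intro l
    induction l with
    | nil => simp
    | cons i l ih =>
      intro hp hk
      rw [List.pairwise_cons] at hp
      rcases List.mem_cons.mp hk with rfl | hk
      · have h1 : l.filter (fun i : Fin n => (k : ℕ) ≤ i) = l.filter (fun i : Fin n => (k : ℕ) + 1 ≤ i) := by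
          refine List.filter_congr fun j hj => ?_
          have : (k : ℕ) < j := hp.1 j hj
          simp only [decide_eq_decide]
          omega
        rw [List.filter_cons_of_pos (by simp), List.filter_cons_of_neg (by simp), h1]
      · have h1 : (i : ℕ) < k := hp.1 k hk
        have h2 : ¬ (k : ℕ) ≤ i := by omega
        have h3 : ¬ (k : ℕ) + 1 ≤ i := by omega
        rw [List.filter_cons_of_neg (by simpa using h2), List.filter_cons_of_neg (by simpa using h3)]
        exact ih hp.2 hk
  exact key _ (List.pairwise_lt_finRange n) (List.mem_finRange k)

end Products

/-! ### Jucys–Murphy elements and the fusion identity -/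

section SymmetricGroup

variable {n : ℕ}

/-- The group algebra of the symmetric group. -/
abbrev SymAlg (n : ℕ) : Type := MonoidAlgebra ℂ (Equiv.Perm (Fin n))

/-- A transposition, as an element of the group algebra. -/
def tr (i j : Fin n) : SymAlg n := MonoidAlgebra.of ℂ _ (Equiv.swap i j)

theorem tr_mul_self (i j : Fin n) : tr i j * tr i j = 1 := by
  rw [tr, ← map_mul, Equiv.swap_mul_self, map_one]

theorem of_mul_tr (σ : Equiv.Perm (Fin n)) (i j : Fin n) :
    MonoidAlgebra.of ℂ _ σ * tr i j = tr (σ i) (σ j) * MonoidAlgebra.of ℂ _ σ := by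
  rw [tr, tr, ← map_mul, ← map_mul, Equiv.mul_swap_eq_swap_mul]

theorem tr_commute {i j k l : Fin n} (h1 : k ≠ i) (h2 : k ≠ j) (h3 : l ≠ i) (h4 : l ≠ j) :
    Commute (tr i j) (tr k l) := by
  have := of_mul_tr (Equiv.swap i j) k l
  rw [Equiv.swap_apply_of_ne_of_ne h1 h2, Equiv.swap_apply_of_ne_of_ne h3 h4] at this
  exact this

/-- The first `k` elements of `Fin n`. -/
def below (n k : ℕ) : Finset (Fin n) := Finset.univ.filter fun i : Fin n => (i : ℕ) < k

@[simp] theorem mem_below {k : ℕ} {i : Fin n} : i ∈ below n k ↔ (i : ℕ) < k := by simp [below]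

theorem below_zero : below n 0 = ∅ := by ext; simp

theorem below_succ (k : Fin n) : below n (k + 1) = insert k (below n k) := by
  ext i
  simp only [mem_below, Finset.mem_insert, Fin.ext_iff]
  omega

/-- The sum of the transpositions that exchange `a` with one of the first `k` indices; for `a = k`
this is the Jucys–Murphy element. -/
def jm (k : ℕ) (a : Fin n) : SymAlg n := ∑ i ∈ below n k, tr i a

theorem jm_succ (k a : Fin n) : jm (k + 1) a = jm k a + tr k a := by
  rw [jm, below_succ, Finset.sum_insert (by simp), add_comm, jm]

/-- Conjugation by the transposition of `k` and `a` fixes the indices below `k` and moves `a` to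
`k`. -/
theorem tr_mul_jm {k a : Fin n} (h : k < a) : tr k a * jm k a = jm k k * tr k a := by
  rw [jm, jm, Finset.mul_sum, Finset.sum_mul]
  refine Finset.sum_congr rfl fun i hi => ?_
  have hi : (i : ℕ) < k := by simpa using hi
  have h1 : i ≠ k := by rintro rfl; omega
  have h2 : i ≠ a := by rintro rfl; have : (k : ℕ) < i := h; omega
  have := of_mul_tr (Equiv.swap k a) i a
  rwa [Equiv.swap_apply_of_ne_of_ne h1 h2, Equiv.swap_apply_right] at this

/-- The subalgebra of the group algebra that is generated by the permutations of the first `k`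
indices. -/
def firstAlg (n k : ℕ) : Subalgebra ℂ (SymAlg n) :=
  Algebra.adjoin ℂ {x | ∃ σ : Equiv.Perm (Fin n), (∀ j : Fin n, k ≤ j → σ j = j) ∧
    x = MonoidAlgebra.of ℂ _ σ}

theorem firstAlg_mono {k l : ℕ} (h : k ≤ l) : firstAlg n k ≤ firstAlg n l := by
  refine Algebra.adjoin_mono ?_
  rintro x ⟨σ, hσ, rfl⟩
  exact ⟨σ, fun j hj => hσ j (h.trans hj), rfl⟩

theorem tr_mem_firstAlg {i j : Fin n} {k : ℕ} (hi : (i : ℕ) < k) (hj : (j : ℕ) < k) :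
    tr i j ∈ firstAlg n k := by
  refine Algebra.subset_adjoin ⟨_, fun l hl => ?_, rfl⟩
  exact Equiv.swap_apply_of_ne_of_ne (by rintro rfl; omega) (by rintro rfl; omega)

theorem jm_mem_firstAlg (k : Fin n) : jm k k ∈ firstAlg n (k + 1) := by
  refine Subalgebra.sum_mem _ fun i hi => ?_
  have hi : (i : ℕ) < k := by simpa using hi
  exact tr_mem_firstAlg (by omega) (by omega)

theorem perm_lt_iff {k : ℕ} {σ : Equiv.Perm (Fin n)} (hσ : ∀ j : Fin n, k ≤ j → σ j = j)
    (i : Fin n) : (σ i : ℕ) < k ↔ (i : ℕ) < k := by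
  constructor
  · intro h
    by_contra h'
    rw [hσ i (by omega)] at h
    exact h' h
  · intro h
    by_contra h'
    have := σ.injective (hσ (σ i) (by omega))
    rw [this] at h'
    exact h' h

theorem commute_of_mem_firstAlg {R : Type*} [Ring R] [Algebra ℂ R] (φ : SymAlg n →ₐ[ℂ] R)
    {k : ℕ} {x : SymAlg n} (hx : x ∈ firstAlg n k) {z : R}
    (hz : ∀ σ : Equiv.Perm (Fin n), (∀ j : Fin n, k ≤ j → σ j = j) →
      Commute (φ (MonoidAlgebra.of ℂ _ σ)) z) : Commute (φ x) z := by
  induction hx using Algebra.adjoin_induction with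
  | mem x hx => obtain ⟨σ, hσ, rfl⟩ := hx; exact hz σ hσ
  | algebraMap c => rw [AlgHom.commutes]; exact Algebra.commutes c z
  | add x y _ _ hx hy => rw [map_add]; exact hx.add_left hy
  | mul x y _ _ hx hy => rw [map_mul]; exact hx.mul_left hy

theorem commute_tr_of_mem_firstAlg {k : ℕ} {x : SymAlg n} (hx : x ∈ firstAlg n k) {i j : Fin n}
    (hi : k ≤ i) (hj : k ≤ j) : Commute x (tr i j) := by
  refine commute_of_mem_firstAlg (AlgHom.id ℂ _) hx fun σ hσ => ?_
  have := of_mul_tr σ i j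
  rwa [hσ i hi, hσ j hj] at this

theorem commute_jm_of_mem_firstAlg {k : ℕ} {x : SymAlg n} (hx : x ∈ firstAlg n k) {a : Fin n}
    (ha : k ≤ a) : Commute x (jm k a) := by
  refine commute_of_mem_firstAlg (AlgHom.id ℂ _) hx fun σ hσ => ?_
  change MonoidAlgebra.of ℂ _ σ * jm k a = jm k a * MonoidAlgebra.of ℂ _ σ
  rw [jm, Finset.mul_sum, Finset.sum_mul]
  refine Finset.sum_equiv σ (fun i => ?_) (fun i _ => ?_)
  · simp [perm_lt_iff hσ]
  · rw [of_mul_tr, hσ a ha]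

/-- The fusion identity for a sequence of elements which are eigenvectors of the Jucys–Murphy
elements. -/
theorem fusion_identity {K R : Type*} [Field K] [Algebra ℂ K] [Ring R] [Algebra K R] [Algebra ℂ R]
    [IsScalarTower ℂ K R] (φ : SymAlg n →ₐ[ℂ] R) {F : ℕ → SymAlg n} {Q : Fin n → SymAlg n}
    {c : Fin n → ℂ} (h0 : F 0 = 1) (hF : ∀ k : Fin n, F (k + 1) = Q k * F k)
    (hx : ∀ k : Fin n, F (k + 1) * jm k k = c k • F (k + 1))
    (hmem : ∀ k, F k ∈ firstAlg n k) {u : K} {k : ℕ} {a : Fin n} (hk : k ≤ a)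
    (hu : ∀ i : Fin n, (i : ℕ) < k → u ≠ algebraMap ℂ K (c i)) :
    φ (F k) * (u • 1 - φ (jm k a)) *
      (((List.finRange n).filter fun i : Fin n => (i : ℕ) < k).map fun i : Fin n =>
        1 - (algebraMap ℂ K (c i) - u)⁻¹ • φ (tr i a)).prod =
    (u * ∏ i ∈ below n k, (1 - ((u - algebraMap ℂ K (c i))⁻¹) ^ 2)) • φ (F k) := by
  induction k with
  | zero => simp [h0, jm, below_zero]
  | succ k ih =>
    obtain ⟨k, rfl⟩ : ∃ k' : Fin n, (k' : ℕ) = k := ⟨⟨k, by omega⟩, rfl⟩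
    have hka : k < a := by rw [Fin.lt_def]; omega
    have huk := hu k (by omega)
    have hd : u - algebraMap ℂ K (c k) ≠ 0 := sub_ne_zero.mpr huk
    specialize ih (by omega) (fun i hi => hu i (by omega))
    set d := u - algebraMap ℂ K (c k) with hd_def
    rw [filter_lt_succ, List.map_append, List.prod_append, below_succ, Finset.prod_insert (by simp),
      jm_succ]
    simp only [List.map_cons, List.map_nil, List.prod_cons, List.prod_nil, mul_one]
    have hsd : (algebraMap ℂ K (c k) - u)⁻¹ = -d⁻¹ := by rw [← inv_neg, hd_def, neg_sub]
    rw [hsd]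
    set B := (((List.finRange n).filter fun i : Fin n => (i : ℕ) < k).map fun i : Fin n =>
        1 - (algebraMap ℂ K (c i) - u)⁻¹ • φ (tr i a)).prod
    set g := u * ∏ i ∈ below n k, (1 - ((u - algebraMap ℂ K (c i))⁻¹) ^ 2)
    have hT2 : φ (tr k a) * φ (tr k a) = 1 := by rw [← map_mul, tr_mul_self, map_one]
    have hTJ : φ (tr k a) * φ (jm k a) = φ (jm k k) * φ (tr k a) := by
      rw [← map_mul, tr_mul_jm hka, map_mul]
    have hFT : φ (F k) * φ (tr k a) = φ (tr k a) * φ (F k) := by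
      rw [← map_mul, (commute_tr_of_mem_firstAlg (hmem k) le_rfl (Fin.le_def.mp hka.le)).eq,
        map_mul]
    have hGJ : φ (F (k + 1)) * φ (jm k k) = algebraMap ℂ K (c k) • φ (F (k + 1)) := by
      rw [← map_mul, hx, map_smul, algebraMap_smul]
    have hG : φ (F (k + 1)) = φ (Q k) * φ (F k) := by rw [hF, map_mul]
    have hck : algebraMap ℂ K (c k) = u - d := by rw [hd_def]; ring
    rw [hck] at hGJ
    rw [map_add]
    set T := φ (tr k a)
    set J := φ (jm k a)
    set G := φ (F (k + 1))
    -- Expanding the right side, `T` commutes past `F k`, and `G T J = G (jm k k) T = (u - d) G T`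
    -- since `G` is an eigenvector. The terms `-(u / d) G T` and `((u - d) / d) G T` add up to `-G
    -- T`.
    have key : G * (u • 1 - (J + T)) = φ (Q k) * (1 - d⁻¹ • T) * (φ (F k) * (u • 1 - J)) := by
      have h1 : φ (Q k) * (1 - d⁻¹ • T) * (φ (F k) * (u • 1 - J)) =
          G * ((1 - d⁻¹ • T) * (u • 1 - J)) := by
        have : (1 - d⁻¹ • T) * φ (F k) = φ (F k) * (1 - d⁻¹ • T) := by
          rw [sub_mul, mul_sub, smul_mul_assoc, mul_smul_comm, hFT, one_mul, mul_one]
        rw [hG, mul_assoc, ← mul_assoc _ (φ (F k)), this]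
        simp only [mul_assoc]
      have h2 : G * (T * J) = (u - d) • (G * T) := by
        rw [hTJ, ← mul_assoc, hGJ, smul_mul_assoc]
      rw [h1]
      simp only [sub_mul, mul_sub, mul_add, smul_mul_assoc, mul_smul_comm, mul_one, one_mul, h2]
      match_scalars <;> field_simp <;> ring
    rw [key]
    have h3 : φ (Q k) * (1 - d⁻¹ • T) * (φ (F k) * (u • 1 - J)) * (B * (1 - -d⁻¹ • T)) =
        φ (Q k) * (1 - d⁻¹ • T) * (φ (F k) * (u • 1 - J) * B) * (1 - -d⁻¹ • T) := by
      simp only [mul_assoc]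
    rw [h3, ih]
    have h4 : φ (Q k) * (1 - d⁻¹ • T) * (g • φ (F k)) * (1 - -d⁻¹ • T) =
        g • (φ (Q k) * ((1 - d⁻¹ • T) * φ (F k)) * (1 - -d⁻¹ • T)) := by
      simp only [mul_smul_comm, smul_mul_assoc, mul_assoc]
    have h5 : (1 - d⁻¹ • T) * φ (F k) = φ (F k) * (1 - d⁻¹ • T) := by
      rw [sub_mul, mul_sub, smul_mul_assoc, mul_smul_comm, hFT, one_mul, mul_one]
    -- The new last factor of the product is `1 + T / d`, and `T` is an involution.
    have h6 : (1 - d⁻¹ • T) * (1 - -d⁻¹ • T) = (1 - d⁻¹ ^ 2) • 1 := by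
      simp only [sub_mul, mul_sub, smul_mul_assoc, mul_smul_comm, mul_one, one_mul, hT2]
      module
    rw [h4, h5, ← mul_assoc, ← hG, mul_assoc, h6, mul_smul_comm, mul_one, smul_smul]
    congr 1
    ring

end SymmetricGroup

/-! ### Row words, contents and the telescoping scalar -/

section Lattice

variable {n : ℕ}

/-- The number of the first `k` entries that lie in row `i`. -/
def rowCount (r : Fin n → ℕ) (k i : ℕ) : ℕ := ((below n k).filter fun j => r j = i).card

/-- The content of the node that can be added in row `i` to the first `k` nodes. -/
def nextContent (r : Fin n → ℕ) (k i : ℕ) : ℂ := (rowCount r k i : ℂ) - i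

/-- The content of the node `k`. -/
def rowContent (r : Fin n → ℕ) (k : Fin n) : ℂ := nextContent r k (r k)

/-- The sequences of rows of standard tableaux. -/
structure IsLattice (r : Fin n → ℕ) : Prop where
  antitone : ∀ k i j, i ≤ j → rowCount r k j ≤ rowCount r k i
  strict : ∀ (k : Fin n) i, i < r k → rowCount r k (r k) < rowCount r k i

theorem rowCount_zero (r : Fin n → ℕ) (i : ℕ) : rowCount r 0 i = 0 := by
  simp [rowCount, below_zero]

theorem rowCount_succ_self (r : Fin n → ℕ) (k : Fin n) :
    rowCount r (k + 1) (r k) = rowCount r k (r k) + 1 := by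
  rw [rowCount, below_succ, Finset.filter_insert, if_pos rfl, Finset.card_insert_of_notMem (by simp),
    rowCount]

theorem rowCount_succ_of_ne (r : Fin n → ℕ) (k : Fin n) {i : ℕ} (h : r k ≠ i) :
    rowCount r (k + 1) i = rowCount r k i := by
  rw [rowCount, below_succ, Finset.filter_insert, if_neg h, rowCount]

theorem nextContent_succ_self (r : Fin n → ℕ) (k : Fin n) :
    nextContent r (k + 1) (r k) = rowContent r k + 1 := by
  rw [nextContent, rowCount_succ_self, rowContent, nextContent]; push_cast; ring

theorem nextContent_succ_of_ne (r : Fin n → ℕ) (k : Fin n) {i : ℕ} (h : r k ≠ i) :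
    nextContent r (k + 1) i = nextContent r k i := by
  rw [nextContent, rowCount_succ_of_ne r k h, nextContent]

/-- Row lengths weakly decrease while `i` increases, so row length minus row index strictly
decreases. -/
theorem IsLattice.nextContent_injective {r : Fin n → ℕ} (hr : IsLattice r) (k : ℕ) :
    Function.Injective (nextContent r k) := by
  intro i j h
  have h' : (rowCount r k i : ℤ) - i = rowCount r k j - j := by
    unfold nextContent at h; exact_mod_cast h
  rcases le_total i j with hij | hij
  · have := hr.antitone k i j hij; omega
  · have := hr.antitone k j i hij; omega

/-- These are the denominators at the evaluation point. A zero would require a row above row `r k`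
of the same length, and then no node could be added in row `r k`. -/
theorem IsLattice.nextContent_ne {r : Fin n → ℕ} (hr : IsLattice r) (k : Fin n) (i : ℕ) :
    rowContent r k - nextContent r k i + 1 ≠ 0 := by
  intro h
  have h' : (rowCount r k (r k) : ℤ) - r k - (rowCount r k i - i) + 1 = 0 := by
    unfold rowContent nextContent at h; exact_mod_cast h
  rcases lt_trichotomy i (r k) with hi | hi | hi
  · have := hr.strict k i hi; omega
  · rw [hi] at h'; omega
  · have := hr.antitone k _ _ hi.le; omega

/-- Adding a node of content `c` changes only the factor of its row, from `(u - c) / (u - c + 1)` to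
`(u - c - 1) / (u - c)`, and the ratio of these is `1 - (u - c)⁻²`. With no nodes, the product over
the `M` empty rows telescopes to `u / (u + M)`. -/
theorem fusion_factor {K : Type*} [Field K] [Algebra ℂ K] {u : K} (hu : ∀ z : ℂ, u ≠ algebraMap ℂ K z)
    (r : Fin n → ℕ) {M : ℕ} (hM : ∀ i, r i < M) {k : ℕ} (hk : k ≤ n) :
    u * ∏ i ∈ below n k, (1 - ((u - algebraMap ℂ K (rowContent r i))⁻¹) ^ 2) =
      (u + M) * ∏ i ∈ Finset.range M, ((u - algebraMap ℂ K (nextContent r k i)) /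
        (u - algebraMap ℂ K (nextContent r k i) + 1)) := by
  have hu' (z : ℂ) : u - algebraMap ℂ K z ≠ 0 := sub_ne_zero.mpr (hu z)
  induction k with
  | zero =>
    simp only [below_zero, Finset.prod_empty, mul_one, nextContent, rowCount_zero]
    clear hM
    induction M with
    | zero => simp
    | succ M ih =>
      rw [Finset.prod_range_succ, ← mul_assoc]
      have h1 := hu' (-(M : ℂ))
      have h2 := hu' (-(M : ℂ) - 1)
      simp only [Nat.cast_zero, zero_sub, map_neg, map_natCast, sub_neg_eq_add, map_sub, map_one]
        at ih h1 h2 ⊢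
      have h3 : u + M + 1 ≠ 0 := by convert h2 using 1; ring
      push_cast
      rw [mul_div_assoc', eq_div_iff h3]
      linear_combination (u + M + 1) * ih
  | succ k ih =>
    obtain ⟨k, rfl⟩ : ∃ k' : Fin n, (k' : ℕ) = k := ⟨⟨k, by omega⟩, rfl⟩
    rw [below_succ, Finset.prod_insert (by simp)]
    have hk' : r k ∈ Finset.range M := Finset.mem_range.mpr (hM k)
    have e1 := Finset.mul_prod_erase (Finset.range M) (fun i =>
      (u - algebraMap ℂ K (nextContent r k i)) / (u - algebraMap ℂ K (nextContent r k i) + 1)) hk'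
    have e2 := Finset.mul_prod_erase (Finset.range M) (fun i =>
      (u - algebraMap ℂ K (nextContent r (k + 1) i)) /
        (u - algebraMap ℂ K (nextContent r (k + 1) i) + 1)) hk'
    have e3 : ∏ i ∈ (Finset.range M).erase (r k), ((u - algebraMap ℂ K (nextContent r (k + 1) i)) /
        (u - algebraMap ℂ K (nextContent r (k + 1) i) + 1)) =
        ∏ i ∈ (Finset.range M).erase (r k), ((u - algebraMap ℂ K (nextContent r k i)) /
        (u - algebraMap ℂ K (nextContent r k i) + 1)) := by
      refine Finset.prod_congr rfl fun i hi => ?_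
      rw [nextContent_succ_of_ne r k (Finset.ne_of_mem_erase hi).symm]
    rw [e3] at e2
    specialize ih (by omega)
    rw [← e1] at ih
    rw [← e2, mul_left_comm, ih, nextContent_succ_self]
    set P := ∏ i ∈ (Finset.range M).erase (r k), ((u - algebraMap ℂ K (nextContent r k i)) /
        (u - algebraMap ℂ K (nextContent r k i) + 1))
    change _ * (_ * ((u - algebraMap ℂ K (rowContent r k)) /
      (u - algebraMap ℂ K (rowContent r k) + 1) * P)) = _
    have h1 := hu' (rowContent r k)
    have h2 := hu' (rowContent r k - 1)
    simp only [map_sub, map_one, map_add, ← sub_add] at h1 h2 ⊢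
    have h4 : u - (algebraMap ℂ K (rowContent r k) + 1) + 1 = u - algebraMap ℂ K (rowContent r k) := by
      ring
    rw [h4]
    field_simp
    ring

end Lattice

/-! ### The fused element as a product of spectral projections -/

section Fused

variable {n : ℕ}

/-- The residue factor that appears in the evaluation at the node `k`. -/
def evalFactor (r : Fin n → ℕ) (M : ℕ) (k : Fin n) : ℂ :=
  ((rowContent r k + M) * ∏ j ∈ (Finset.range M).erase (r k), (rowContent r k - nextContent r k j)) /
    ∏ j ∈ Finset.range M, (rowContent r k - nextContent r k j + 1)

/-- The Lagrange idempotent of the Jucys–Murphy element `k` that belongs to row `i`. -/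
def rowProj (r : Fin n → ℕ) (M : ℕ) (k : Fin n) (i : ℕ) : SymAlg n :=
  Polynomial.aeval (jm k k) (Lagrange.basis (Finset.range M) (nextContent r k) i)

/-- The step from `k` nodes to `k + 1` nodes. -/
def fusedStep (r : Fin n → ℕ) (M : ℕ) (k : Fin n) : SymAlg n :=
  evalFactor r M k • rowProj r M k (r k)

/-- The result of the evaluation in the group algebra, for the first `k` nodes. -/
def fused (r : Fin n → ℕ) (M : ℕ) : ℕ → SymAlg n
  | 0 => 1
  | k + 1 => if h : k < n then fusedStep r M ⟨k, h⟩ * fused r M k else fused r M k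

theorem fused_zero (r : Fin n → ℕ) (M : ℕ) : fused r M 0 = 1 := rfl

theorem fused_succ (r : Fin n → ℕ) (M : ℕ) (k : Fin n) :
    fused r M (k + 1) = fusedStep r M k * fused r M k := by
  rw [fused, dif_pos k.2]

theorem rowProj_mem_firstAlg (r : Fin n → ℕ) (M : ℕ) (k : Fin n) (i : ℕ) :
    rowProj r M k i ∈ firstAlg n (k + 1) := by
  have : rowProj r M k i ∈ Algebra.adjoin ℂ {jm (k : ℕ) k} := Polynomial.aeval_mem_adjoin_singleton ℂ _
  exact Algebra.adjoin_le (by simpa using jm_mem_firstAlg k) this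

theorem fused_mem_firstAlg (r : Fin n → ℕ) (M : ℕ) (k : ℕ) : fused r M k ∈ firstAlg n k := by
  induction k with
  | zero => exact one_mem _
  | succ k ih =>
    rw [fused]
    split_ifs with h
    · exact mul_mem (Subalgebra.smul_mem _ (rowProj_mem_firstAlg r M ⟨k, h⟩ _) _)
        (firstAlg_mono (Nat.le_succ k) ih)
    · exact firstAlg_mono (Nat.le_succ k) ih

/-- The minimal polynomial of the Jucys–Murphy element annihilates the element `fused`. -/
def NodalVanishing (r : Fin n → ℕ) (M : ℕ) (k : Fin n) : Prop :=
  Polynomial.aeval (jm (k : ℕ) k) (Lagrange.nodal (Finset.range M) (nextContent r k)) * fused r M k = 0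

/-- Multiplied by `X - d_i`, the Lagrange polynomial of `d_i` becomes a constant multiple of the
nodal polynomial, which annihilates `fused r M k`. -/
theorem jm_mul_rowProj {r : Fin n → ℕ} {M : ℕ} {k : Fin n} (h : NodalVanishing r M k) {i : ℕ}
    (hi : i < M) : jm k k * (rowProj r M k i * fused r M k) =
      nextContent r k i • (rowProj r M k i * fused r M k) := by
  have hi' := Finset.mem_range.mpr hi
  have h1 : (Polynomial.X - Polynomial.C (nextContent r k i)) *
      Lagrange.basis (Finset.range M) (nextContent r k) i =
      Polynomial.C (Lagrange.nodalWeight (Finset.range M) (nextContent r k) i) *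
        Lagrange.nodal (Finset.range M) (nextContent r k) := by
    rw [Lagrange.basis_eq_prod_sub_inv_mul_nodal_div hi', mul_left_comm]
    rw [Lagrange.nodal_eq_mul_nodal_erase hi', mul_div_cancel_left₀]
    exact Polynomial.X_sub_C_ne_zero _
  have h2 := congrArg (fun p => Polynomial.aeval (jm (k : ℕ) k) p * fused r M k) h1
  simp only [map_mul, map_sub, Polynomial.aeval_X, Polynomial.aeval_C] at h2
  rw [mul_assoc, mul_assoc (algebraMap ℂ (SymAlg n) _), h, mul_zero, sub_mul, sub_eq_zero] at h2
  rw [rowProj, h2, Algebra.smul_def]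

theorem commute_jm_fused (r : Fin n → ℕ) (M : ℕ) (k : Fin n) :
    Commute (jm (k : ℕ) k) (fused r M k) :=
  (commute_jm_of_mem_firstAlg (fused_mem_firstAlg r M k) le_rfl).symm

theorem commute_jm_rowProj (r : Fin n → ℕ) (M : ℕ) (k : Fin n) (i : ℕ) :
    Commute (jm (k : ℕ) k) (rowProj r M k i) := by
  have := congrArg (Polynomial.aeval (jm (k : ℕ) k))
    (mul_comm Polynomial.X (Lagrange.basis (Finset.range M) (nextContent r k) i))
  simp only [map_mul, Polynomial.aeval_X] at this
  exact this

theorem jm_mul_fused_succ {r : Fin n → ℕ} {M : ℕ} (hM : ∀ i, r i < M) {k : Fin n}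
    (h : NodalVanishing r M k) :
    jm k k * fused r M (k + 1) = rowContent r k • fused r M (k + 1) := by
  rw [fused_succ, fusedStep, smul_mul_assoc, mul_smul_comm, jm_mul_rowProj h (hM k), smul_comm,
    rowContent]

theorem fused_succ_mul_jm {r : Fin n → ℕ} {M : ℕ} (hM : ∀ i, r i < M) {k : Fin n}
    (h : NodalVanishing r M k) :
    fused r M (k + 1) * jm k k = rowContent r k • fused r M (k + 1) := by
  rw [← jm_mul_fused_succ hM h, fused_succ]
  refine Commute.eq ((Commute.mul_left ?_ (commute_jm_fused r M k).symm))
  exact ((commute_jm_rowProj r M k _).symm).smul_left _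

end Fused

/-! ### Consecutive evaluation in the group algebra -/

section SymEvaluation

variable {n : ℕ}

/-- The fusion product in the group algebra of the symmetric group. -/
def symF (n : ℕ) : RatFn n ⊗[ℂ] SymAlg n :=
  ((List.finRange n).flatMap fun i =>
    ((List.finRange n).filter fun j => i < j).map fun j =>
      1 - (ratVar i - ratVar j)⁻¹ ⊗ₜ[ℂ] tr i j).prod

/-- The variable `i`, specialised to `c i` if it is one of the first `k` variables. -/
def specVar (c : Fin n → ℂ) (k : ℕ) (i : Fin n) : Poly n :=
  if (i : ℕ) < k then MvPolynomial.C (c i) else MvPolynomial.X i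

/-- The part of the fusion product whose factors exchange `j` with a smaller index, with the first
`k` variables specialised. -/
def column (c : Fin n → ℂ) (k : ℕ) (j : Fin n) : RatFn n ⊗[ℂ] SymAlg n :=
  (((List.finRange n).filter fun i : Fin n => (i : ℕ) < j).map fun i : Fin n =>
    1 - (algebraMap (Poly n) (RatFn n) (specVar c k i) - ratVar j)⁻¹ ⊗ₜ[ℂ] tr i j).prod

theorem symF_eq_prod_column (c : Fin n → ℂ) :
    symF n = ((List.finRange n).map (column c 0)).prod := by
  rw [symF, lex_prod_eq_colex_prod (fun i j => 1 - (ratVar i - ratVar j)⁻¹ ⊗ₜ[ℂ] tr i j)]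
  · rfl
  · intro i k l j hik hkl hlj
    have hc : Commute ((ratVar i - ratVar j)⁻¹ ⊗ₜ[ℂ] tr i j)
        ((ratVar k - ratVar l)⁻¹ ⊗ₜ[ℂ] tr k l) := by
      rw [Commute, SemiconjBy, Algebra.TensorProduct.tmul_mul_tmul,
        Algebra.TensorProduct.tmul_mul_tmul, mul_comm,
        (tr_commute hik.ne' (hkl.trans hlj).ne (hik.trans hkl).ne' hlj.ne).eq]
    exact (Commute.one_left _).sub_left ((Commute.one_right _).sub_right hc)

theorem substPoly_X_self (k : Fin n) (a : ℂ) :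
    substPoly k a (MvPolynomial.X k) = MvPolynomial.C a := by simp [substPoly]

theorem substPoly_X_of_ne {k j : Fin n} (h : j ≠ k) (a : ℂ) :
    substPoly k a (MvPolynomial.X j) = MvPolynomial.X j := by simp [substPoly, h]

theorem substPoly_C (k : Fin n) (a z : ℂ) :
    substPoly k a (MvPolynomial.C z) = MvPolynomial.C z := by
  rw [← MvPolynomial.algebraMap_eq, AlgHom.commutes]

theorem substPoly_specVar (c : Fin n → ℂ) (k i : Fin n) :
    substPoly k (c k) (specVar c k i) = specVar c (k + 1) i := by
  unfold specVar
  rcases lt_trichotomy (i : ℕ) k with h | h | h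
  · rw [if_pos h, if_pos (by omega), substPoly_C]
  · obtain rfl := Fin.ext h
    rw [if_neg (by omega), if_pos (by omega), substPoly_X_self]
  · rw [if_neg (by omega), if_neg (by omega), substPoly_X_of_ne]
    rintro rfl; omega

theorem specVar_sub_X_ne_zero (c : Fin n → ℂ) (k : ℕ) {i j : Fin n} (h : i ≠ j) :
    specVar c k i - MvPolynomial.X j ≠ 0 := by
  intro h0
  unfold specVar at h0
  split_ifs at h0
  · have := congrArg (MvPolynomial.eval fun _ => c i + 1) h0
    simp at this
  · have := congrArg (MvPolynomial.eval (Pi.single j 1)) h0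
    simp [h] at this

/-- Since `k < j`, the variable `u_j` is still free, so no denominator `u_i - u_j` or `c i - u_j`
vanishes on the hyperplane. -/
theorem isEvalAt_column (c : Fin n → ℂ) {k j : Fin n} (h : k < j) :
    IsEvalAt k (c k) (column c k j) (column c (k + 1) j) := by
  refine IsEvalAt.list_prod _ fun i hi => ?_
  have hi : i < j := by simpa using hi
  have h1 := specVar_sub_X_ne_zero c k hi.ne
  have h2 := specVar_sub_X_ne_zero c (k + 1) hi.ne
  have hs : substPoly k (c k) (specVar c k i - MvPolynomial.X j) =
      specVar c (k + 1) i - MvPolynomial.X j := by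
    rw [map_sub, substPoly_specVar, substPoly_X_of_ne h.ne']
  have key := isEvalAt_tmul (k := k) (a := c k) (p := 1) (q := specVar c k i - MvPolynomial.X j)
    (v := (algebraMap (Poly n) (RatFn n) (specVar c k i) - ratVar j)⁻¹)
    (w := (algebraMap (Poly n) (RatFn n) (specVar c (k + 1) i) - ratVar j)⁻¹)
    (x := -tr i j) (by rwa [hs])
    (by
      rw [map_sub, map_one]
      refine mul_inv_cancel₀ ?_
      change _ - algebraMap (Poly n) (RatFn n) (MvPolynomial.X j) ≠ 0
      rw [← map_sub]
      exact fun h0 => h1 (IsFractionRing.injective (Poly n) (RatFn n) (h0.trans (map_zero _).symm)))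
    (by
      rw [hs, map_sub, map_one, map_one]
      refine mul_inv_cancel₀ ?_
      change _ - algebraMap (Poly n) (RatFn n) (MvPolynomial.X j) ≠ 0
      rw [← map_sub]
      exact fun h0 => h2 (IsFractionRing.injective (Poly n) (RatFn n) (h0.trans (map_zero _).symm)))
  rw [TensorProduct.tmul_neg, TensorProduct.tmul_neg] at key
  simpa only [sub_eq_add_neg] using (isEvalAt_one k (c k)).add key

theorem ratVar_ne_algebraMap (k : Fin n) (z : ℂ) : ratVar k ≠ algebraMap ℂ (RatFn n) z := by
  intro h
  rw [IsScalarTower.algebraMap_apply ℂ (Poly n) (RatFn n), ratVar] at h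
  have h1 := IsFractionRing.injective (Poly n) (RatFn n) h
  have := congrArg (MvPolynomial.eval fun _ => z + 1) h1
  simp [MvPolynomial.algebraMap_eq] at this

theorem algebraMap_specVar_of_lt (c : Fin n → ℂ) {k : ℕ} {i : Fin n} (h : (i : ℕ) < k) :
    algebraMap (Poly n) (RatFn n) (specVar c k i) = algebraMap ℂ (RatFn n) (c i) := by
  rw [specVar, if_pos h, IsScalarTower.algebraMap_apply ℂ (Poly n) (RatFn n),
    MvPolynomial.algebraMap_eq]

variable {r : Fin n → ℕ} {M : ℕ}

theorem prod_sub_add_one_ne_zero {K : Type*} [Field K] [Algebra ℂ K] {u : K}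
    (hu : ∀ z : ℂ, u ≠ algebraMap ℂ K z) (s : Finset ℕ) (f : ℕ → ℂ) :
    ∏ j ∈ s, (u - algebraMap ℂ K (f j) + 1) ≠ 0 := by
  refine Finset.prod_ne_zero_iff.mpr fun j _ h => hu (f j - 1) ?_
  rw [map_sub, map_one]; linear_combination h

/-- The spectral decomposition of the part of the fusion product that is singular at the next
evaluation. -/
theorem fused_mul_column {K R : Type*} [Field K] [Algebra ℂ K] [Ring R] [Algebra K R] [Algebra ℂ R]
    [IsScalarTower ℂ K R] (φ : SymAlg n →ₐ[ℂ] R) (hr : IsLattice r) (hM : ∀ i, r i < M)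
    (hM0 : 0 < M) (hp : ∀ k, NodalVanishing r M k) {u : K} (hu : ∀ z : ℂ, u ≠ algebraMap ℂ K z)
    (k : Fin n) :
    φ (fused r M k) * (((List.finRange n).filter fun i : Fin n => (i : ℕ) < k).map fun i : Fin n =>
        1 - (algebraMap ℂ K (rowContent r i) - u)⁻¹ • φ (tr i k)).prod =
      ∑ i ∈ Finset.range M,
        ((∏ j ∈ Finset.range M, (u - algebraMap ℂ K (nextContent r k j) + 1))⁻¹ *
          ((u + (M : K)) * ∏ j ∈ (Finset.range M).erase i,
            (u - algebraMap ℂ K (nextContent r k j)))) • φ (rowProj r M k i * fused r M k) := by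
  have hid := fusion_identity φ (fused_zero r M) (fused_succ r M)
    (fun k => fused_succ_mul_jm hM (hp k)) (fused_mem_firstAlg r M) (u := u) (k := k) (a := k) le_rfl
    (fun i _ => hu _)
  rw [fusion_factor hu r hM k.2.le] at hid
  set B := (((List.finRange n).filter fun i : Fin n => (i : ℕ) < k).map fun i : Fin n =>
        1 - (algebraMap ℂ K (rowContent r i) - u)⁻¹ • φ (tr i k)).prod
  obtain ⟨Y, hY⟩ : ∃ Y, Y = φ (fused r M k) * B := ⟨_, rfl⟩
  rw [← hY]
  set g := (u + (M : K)) * ∏ i ∈ Finset.range M, ((u - algebraMap ℂ _ (nextContent r k i)) /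
        (u - algebraMap ℂ _ (nextContent r k i) + 1)) with hg
  have hcomm : φ (fused r M k) * (u • 1 - φ (jm k k)) = (u • 1 - φ (jm k k)) * φ (fused r M k) := by
    rw [mul_sub, sub_mul, mul_smul_comm, smul_mul_assoc, mul_one, one_mul, ← map_mul, ← map_mul,
      (commute_jm_fused r M k).eq]
  rw [hcomm, mul_assoc, ← hY] at hid
  have hinj : Set.InjOn (nextContent r k) (Finset.range M) := (hr.nextContent_injective k).injOn
  -- The Lagrange polynomials sum to `1`, so `Y` splits into its `J_k`-eigencomponents.
  have hsum : ∑ i ∈ Finset.range M, φ (rowProj r M k i) = 1 := by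
    rw [← map_sum]
    simp only [rowProj]
    rw [← map_sum, Lagrange.sum_basis hinj ⟨0, by simpa using hM0⟩, map_one, map_one]
  rw [← one_mul Y, ← hsum, Finset.sum_mul]
  refine Finset.sum_congr rfl fun i hi => ?_
  have hub : u - algebraMap ℂ _ (nextContent r k i) ≠ 0 := sub_ne_zero.mpr (hu _)
  have h1 : φ (jm k k) * (φ (rowProj r M k i) * Y) =
      algebraMap ℂ K (nextContent r k i) • (φ (rowProj r M k i) * Y) := by
    rw [hY, ← mul_assoc (φ (rowProj r M k i)), ← mul_assoc, ← map_mul, ← map_mul,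
      jm_mul_rowProj (hp k) (Finset.mem_range.mp hi), map_smul, smul_mul_assoc, algebraMap_smul]
  -- On the component of row `i` the operator `u - J_k` is the scalar `u - d_i`, which is invertible
  -- because `u` is transcendental over the constants in the sense of `hu`: it differs from each of
  -- them.
  have h2 : (u - algebraMap ℂ _ (nextContent r k i)) • (φ (rowProj r M k i) * Y) =
      g • φ (rowProj r M k i * fused r M k) := by
    have : φ (rowProj r M k i) * ((u • 1 - φ (jm k k)) * Y) =
        u • (φ (rowProj r M k i) * Y) - φ (jm k k) * (φ (rowProj r M k i) * Y) := by
      rw [sub_mul, mul_sub, smul_mul_assoc, one_mul, mul_smul_comm, ← mul_assoc, ← mul_assoc,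
        ← map_mul, ← map_mul, (commute_jm_rowProj r M k i).eq]
    rw [sub_smul, ← h1, ← this, hid, mul_smul_comm, ← map_mul]
  have h3 : φ (rowProj r M k i) * Y = ((u - algebraMap ℂ _ (nextContent r k i))⁻¹ * g) •
      φ (rowProj r M k i * fused r M k) := by
    rw [mul_smul, ← h2, inv_smul_smul₀ hub]
  rw [h3, hg, Finset.prod_div_distrib, ← Finset.mul_prod_erase (Finset.range M)
    (fun i => u - algebraMap ℂ K (nextContent r k i)) hi]
  congr 1
  have hne := prod_sub_add_one_ne_zero hu (Finset.range M) (nextContent r k)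
  field_simp

/-- In the spectral decomposition the factor `u - d_i` of the numerator has cancelled the pole of
the resolvent, and the remaining denominators `u - d_j + 1` do not vanish at the content. -/
theorem isEvalAt_fused_mul_column (hr : IsLattice r) (hM : ∀ i, r i < M)
    (hp : ∀ k, NodalVanishing r M k) (k : Fin n) :
    IsEvalAt k (rowContent r k) ((1 ⊗ₜ[ℂ] fused r M k) * column (rowContent r) k k)
      (1 ⊗ₜ[ℂ] fused r M (k + 1)) := by
  set φ : SymAlg n →ₐ[ℂ] RatFn n ⊗[ℂ] SymAlg n := Algebra.TensorProduct.includeRight with hφ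
  have hφ1 (x : SymAlg n) : φ x = 1 ⊗ₜ[ℂ] x := rfl
  have hsm (v : RatFn n) (x : SymAlg n) : v • φ x = v ⊗ₜ[ℂ] x := by
    rw [hφ1, TensorProduct.smul_tmul', smul_eq_mul, mul_one]
  have hu := ratVar_ne_algebraMap k
  have hcol : column (rowContent r) k k = (((List.finRange n).filter fun i : Fin n =>
      (i : ℕ) < k).map fun i : Fin n =>
        1 - (algebraMap ℂ (RatFn n) (rowContent r i) - ratVar k)⁻¹ • φ (tr i k)).prod := by
    rw [column]
    congr 1
    refine List.map_congr_left fun i hi => ?_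
    have hi : (i : ℕ) < k := by simpa using hi
    rw [algebraMap_specVar_of_lt _ hi, hsm]
  rw [hcol, ← hφ1, fused_mul_column φ hr hM (Nat.zero_lt_of_lt (hM k)) hp hu k]
  set num : ℕ → Poly n := fun i => (MvPolynomial.X k + (M : Poly n)) *
    ∏ j ∈ (Finset.range M).erase i, (MvPolynomial.X k - MvPolynomial.C (nextContent r k j))
    with hnum_def
  set den : Poly n :=
    ∏ j ∈ Finset.range M, (MvPolynomial.X k - MvPolynomial.C (nextContent r k j) + 1) with hden_def
  set num' : ℕ → ℂ := fun i => (rowContent r k + M) *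
    ∏ j ∈ (Finset.range M).erase i, (rowContent r k - nextContent r k j) with hnum'_def
  set den' : ℂ := ∏ j ∈ Finset.range M, (rowContent r k - nextContent r k j + 1) with hden'
  have hden0 : den' ≠ 0 := Finset.prod_ne_zero_iff.mpr fun j _ => hr.nextContent_ne k j
  have hnum (i : ℕ) : substPoly k (rowContent r k) (num i) = MvPolynomial.C (num' i) := by
    simp only [hnum_def, hnum'_def, map_mul, map_add, map_prod, map_sub, substPoly_X_self,
      substPoly_C, map_natCast]
  have hden : substPoly k (rowContent r k) den = MvPolynomial.C den' := by
    simp only [hden_def, hden', map_add, map_prod, map_sub, substPoly_X_self, substPoly_C, map_one]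
  have hC (z : ℂ) : algebraMap (Poly n) (RatFn n) (MvPolynomial.C z) = algebraMap ℂ (RatFn n) z := by
    rw [IsScalarTower.algebraMap_apply ℂ (Poly n) (RatFn n), MvPolynomial.algebraMap_eq]
  have hX : algebraMap (Poly n) (RatFn n) (MvPolynomial.X k) = ratVar k := rfl
  have hval : (1 : RatFn n) ⊗ₜ[ℂ] fused r M (k + 1) = ∑ i ∈ Finset.range M,
      (algebraMap ℂ (RatFn n) (num' i / den')) ⊗ₜ[ℂ] (rowProj r M k i * fused r M k) := by
    rw [Finset.sum_eq_single (r k)]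
    · rw [fused_succ, fusedStep, smul_mul_assoc, TensorProduct.tmul_smul, TensorProduct.smul_tmul',
        Algebra.smul_def, mul_one]
      rfl
    · intro i _ hi
      -- For `i ≠ r k` the product still contains the factor of row `r k`, which vanishes at the
      -- content.
      have : num' i = 0 := by
        have : rowContent r k - nextContent r k (r k) = 0 := sub_self _
        simp only [hnum'_def]
        rw [Finset.prod_eq_zero (Finset.mem_erase.mpr ⟨hi.symm, Finset.mem_range.mpr (hM k)⟩) this,
          mul_zero]
      rw [this, zero_div, map_zero, TensorProduct.zero_tmul]
    · intro h; exact absurd (Finset.mem_range.mpr (hM k)) h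
  rw [hval]
  refine IsEvalAt.sum _ fun i _ => ?_
  rw [hsm]
  refine isEvalAt_tmul (p := num i) (q := den) ?_ ?_ ?_ _
  · rw [hden]; simpa using hden0
  · have h1 : algebraMap (Poly n) (RatFn n) (num i) = (ratVar k + (M : RatFn n)) *
        ∏ j ∈ (Finset.range M).erase i, (ratVar k - algebraMap ℂ (RatFn n) (nextContent r k j)) := by
      simp only [hnum_def, map_mul, map_add, map_prod, map_sub, hC, map_natCast, hX]
    have h2 : algebraMap (Poly n) (RatFn n) den =
        ∏ j ∈ Finset.range M, (ratVar k - algebraMap ℂ (RatFn n) (nextContent r k j) + 1) := by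
      simp only [hden_def, map_add, map_prod, map_sub, hC, map_one, hX]
    rw [h1, h2]
    exact mul_inv_cancel_left₀ (prod_sub_add_one_ne_zero hu _ _) _
  · rw [hden, hnum, hC, hC, ← map_mul, mul_div_cancel₀ _ hden0]

/-- The consecutive evaluations of the fusion product in the group algebra. -/
theorem isConsecutiveEval_symF (hr : IsLattice r) (hM : ∀ i, r i < M)
    (hp : ∀ k, NodalVanishing r M k) :
    IsConsecutiveEval (symF n) (rowContent r) (fused r M n) := by
  -- The function before step `k`: the columns below `k` are already fused, and those from `k` on
  -- have their first `k` variables specialised.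
  refine ⟨fun k => (1 ⊗ₜ[ℂ] fused r M k) * (((List.finRange n).filter fun j : Fin n =>
    (k : ℕ) ≤ j).map (column (rowContent r) k)).prod, ?_, fun k => ?_, ?_⟩
  · have h1 : (List.finRange n).filter (fun j : Fin n => (((0 : Fin (n + 1)) : ℕ)) ≤ j) =
      List.finRange n := by rw [List.filter_eq_self]; simp
    simp only [h1]
    rw [symF_eq_prod_column (rowContent r)]
    exact one_mul _
  · simp only [Fin.val_castSucc, Fin.val_succ]
    rw [filter_le_eq_cons, List.map_cons, List.prod_cons, ← mul_assoc]
    refine (isEvalAt_fused_mul_column hr hM hp k).mul (IsEvalAt.list_prod _ fun j hj => ?_)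
    have hj : (k : ℕ) + 1 ≤ j := by
      have := List.mem_filter.mp hj
      exact of_decide_eq_true this.2
    exact isEvalAt_column _ (Fin.lt_def.mpr (by omega))
  · have h1 : (List.finRange n).filter (fun j : Fin n => n ≤ (j : ℕ)) = [] := by
      rw [List.filter_eq_nil_iff]; simp
    simp only [Fin.val_last, h1, List.map_nil, List.prod_nil, mul_one]

end SymEvaluation

/-! ### Commuting actions of permutations and matrix units on words -/

section Words

variable {n N : ℕ}

/-- Functions on words of length `n` in `N` letters: the coordinates of tensors. -/
abbrev WordFn (n N : ℕ) : Type := (Fin n → Fin N) → ℂ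

/-- The action of a permutation of the tensor factors. -/
def permAct (n N : ℕ) : Equiv.Perm (Fin n) →* Module.End ℂ (WordFn n N) where
  toFun σ := LinearMap.funLeft ℂ ℂ fun w => w ∘ σ
  map_one' := rfl
  map_mul' _ _ := rfl

theorem permAct_apply (σ : Equiv.Perm (Fin n)) (f : WordFn n N) (w : Fin n → Fin N) :
    permAct n N σ f w = f (w ∘ σ) := rfl

/-- The action of the group algebra of the symmetric group. -/
def wordRep (n N : ℕ) : SymAlg n →ₐ[ℂ] Module.End ℂ (WordFn n N) :=
  MonoidAlgebra.lift ℂ (Module.End ℂ (WordFn n N)) (Equiv.Perm (Fin n)) (permAct n N)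

@[simp] theorem wordRep_of (σ : Equiv.Perm (Fin n)) :
    wordRep n N (MonoidAlgebra.of ℂ _ σ) = permAct n N σ := by
  simp [wordRep]

/-- The matrix unit `E_{a,b}` in the tensor factor `i`. -/
def slot (i : Fin n) (a b : Fin N) : Module.End ℂ (WordFn n N) where
  toFun f w := if w i = a then f (Function.update w i b) else 0
  map_add' f g := by ext w; by_cases h : w i = a <;> simp [h]
  map_smul' c f := by ext w; by_cases h : w i = a <;> simp [h]

theorem slot_apply (i : Fin n) (a b : Fin N) (f : WordFn n N) (w : Fin n → Fin N) :
    slot i a b f w = if w i = a then f (Function.update w i b) else 0 := rfl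

theorem slot_mul_slot (i : Fin n) (a b d : Fin N) : slot i a b * slot i b d = slot i a d := by
  refine LinearMap.ext fun f => funext fun w => ?_
  simp [Module.End.mul_apply, slot_apply]

theorem slot_mul_slot_of_ne (i : Fin n) {a b c d : Fin N} (h : b ≠ c) :
    slot i a b * slot i c d = 0 := by
  refine LinearMap.ext fun f => funext fun w => ?_
  simp [Module.End.mul_apply, slot_apply, h]

theorem slot_commute {i j : Fin n} (h : i ≠ j) (a b c d : Fin N) :
    Commute (slot i a b) (slot j c d) := by
  refine LinearMap.ext fun f => funext fun w => ?_
  by_cases h1 : w i = a <;> by_cases h2 : w j = c <;>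
    simp [Module.End.mul_apply, slot_apply, h1, h2, h, h.symm, Function.update_comm h]

theorem permAct_mul_slot (σ : Equiv.Perm (Fin n)) (i : Fin n) (a b : Fin N) :
    permAct n N σ * slot i a b = slot (σ i) a b * permAct n N σ := by
  refine LinearMap.ext fun f => funext fun w => ?_
  have : Function.update (w ∘ σ) i b = Function.update w (σ i) b ∘ σ := by
    rw [Function.update_comp_eq_of_injective _ σ.injective]
  simp only [Module.End.mul_apply, slot_apply, permAct_apply, Function.comp_apply, this]

theorem sum_slot (i : Fin n) : ∑ a : Fin N, slot i a a = 1 := by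
  refine LinearMap.ext fun f => funext fun w => ?_
  simp only [LinearMap.sum_apply, Finset.sum_apply, slot_apply]
  rw [Finset.sum_ite_eq Finset.univ (w i)]
  simp

theorem permAct_swap {i j : Fin n} (h : i ≠ j) :
    permAct n N (Equiv.swap i j) = ∑ a, ∑ b, slot i a b * slot j b a := by
  refine LinearMap.ext fun f => funext fun w => ?_
  simp only [LinearMap.sum_apply, Finset.sum_apply, slot_apply, Module.End.mul_apply,
    Function.update_of_ne h.symm]
  rw [Finset.sum_eq_single (w i)]
  · simp only [if_true]
    rw [Finset.sum_ite_eq Finset.univ (w j)]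
    simp only [Finset.mem_univ, if_true, permAct_apply]
    congr 1
    funext l
    by_cases h1 : l = i
    · subst h1; simp [h]
    · by_cases h2 : l = j
      · subst h2; simp
      · simp [h1, h2, Equiv.swap_apply_of_ne_of_ne h1 h2]
  · intro a _ ha
    refine Finset.sum_eq_zero fun b _ => if_neg ha.symm
  · simp

/-- The action of `E_{a,b}` on the first `k` tensor factors. -/
def low (k : ℕ) (a b : Fin N) : Module.End ℂ (WordFn n N) := ∑ j ∈ below n k, slot j a b

theorem low_succ (k : Fin n) (a b : Fin N) :
    (low (k + 1) a b : Module.End ℂ (WordFn n N)) = low k a b + slot k a b := by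
  rw [low, below_succ, Finset.sum_insert (by simp), add_comm, low]

theorem low_commute_slot {k : ℕ} {i : Fin n} (h : k ≤ i) (a b c d : Fin N) :
    Commute (low k a b) (slot i c d) := by
  refine Commute.sum_left _ _ _ fun j hj => slot_commute ?_ a b c d
  rintro rfl
  rw [mem_below] at hj
  omega

theorem low_mul_low (k : ℕ) (a b c d : Fin N) :
    (low k a b : Module.End ℂ (WordFn n N)) * low k c d = low k c d * low k a b +
      (if b = c then low k a d else 0) - (if d = a then low k c b else 0) := by
  have h1 : (low k a b : Module.End ℂ (WordFn n N)) * low k c d - low k c d * low k a b =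
      ∑ j ∈ below n k, (slot j a b * slot j c d - slot j c d * slot j a b) := by
    simp only [low, Finset.sum_mul_sum]
    rw [Finset.sum_comm (f := fun i j => slot i c d * slot j a b), ← Finset.sum_sub_distrib]
    refine Finset.sum_congr rfl fun i hi => ?_
    rw [← Finset.sum_sub_distrib, Finset.sum_eq_single i]
    · intro j _ hj
      rw [(slot_commute hj.symm a b c d).eq, sub_self]
    · exact fun h => absurd hi h
  have h2 : ∑ j ∈ below n k, (slot j a b * slot j c d - slot j c d * slot j a b) =
      ((if b = c then low k a d else 0) - (if d = a then low k c b else 0) :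
        Module.End ℂ (WordFn n N)) := by
    rw [Finset.sum_sub_distrib]
    congr 1
    · split_ifs with h
      · subst h; simp only [slot_mul_slot, low]
      · simp only [slot_mul_slot_of_ne _ h, Finset.sum_const_zero]
    · split_ifs with h
      · subst h; simp only [slot_mul_slot, low]
      · simp only [slot_mul_slot_of_ne _ h, Finset.sum_const_zero]
  rw [add_sub_assoc, ← h2, ← h1]
  abel

/-- The Jucys–Murphy element becomes the split Casimir operator between the first `k` factors and
factor `k`. This is the link between its spectrum and weights. -/
theorem wordRep_jm (k : Fin n) :
    wordRep n N (jm k k) = ∑ a, ∑ b, low k a b * slot k b a := by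
  have : ∀ j ∈ below n k, wordRep n N (tr j k) = ∑ a, ∑ b, slot j a b * slot k b a := by
    intro j hj
    rw [tr, wordRep_of, permAct_swap]
    rintro rfl
    simp at hj
  rw [jm, map_sum, Finset.sum_congr rfl this, Finset.sum_comm]
  refine Finset.sum_congr rfl fun a _ => ?_
  rw [Finset.sum_comm]
  refine Finset.sum_congr rfl fun b _ => ?_
  rw [low, Finset.sum_mul]

theorem wordRep_commute_slot {k : ℕ} {x : SymAlg n} (hx : x ∈ firstAlg n k) {i : Fin n} (hi : k ≤ i)
    (a b : Fin N) : Commute (wordRep n N x) (slot i a b) := by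
  refine commute_of_mem_firstAlg (wordRep n N) hx fun σ hσ => ?_
  rw [wordRep_of]
  have := permAct_mul_slot (N := N) σ i a b
  rwa [hσ i hi] at this

theorem wordRep_commute_low {k : ℕ} {x : SymAlg n} (hx : x ∈ firstAlg n k) {l : ℕ} (hl : k ≤ l)
    (a b : Fin N) : Commute (wordRep n N x) (low l a b) := by
  refine commute_of_mem_firstAlg (wordRep n N) (firstAlg_mono hl hx) fun σ hσ => ?_
  rw [wordRep_of, Commute, SemiconjBy, low, Finset.mul_sum, Finset.sum_mul]
  refine Finset.sum_equiv σ (fun i => ?_) (fun i _ => permAct_mul_slot σ i a b)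
  simp [perm_lt_iff hσ]

/-- The vectors that are annihilated by the `E_{a,b}` with `a < b`, acting on the first `k`
factors. -/
def IsSing (k : ℕ) (y : WordFn n N) : Prop := ∀ a b : Fin N, a < b → low k a b y = 0

/-- Take a nonzero vector of `S` whose support has the smallest bound on the sum of the first `k`
letters. Applying `E_{a,b}` with `a < b` lowers that bound, so the result is zero. -/
theorem exists_isSing {k : ℕ} {S : Submodule ℂ (WordFn n N)}
    (hS : ∀ a b : Fin N, a < b → ∀ y ∈ S, low k a b y ∈ S) (h0 : S ≠ ⊥) :
    ∃ y ∈ S, y ≠ 0 ∧ IsSing k y := by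
  classical
  let ht : (Fin n → Fin N) → ℕ := fun w => ∑ j ∈ below n k, (w j : ℕ)
  let p : ℕ → Prop := fun m => ∃ y ∈ S, y ≠ 0 ∧ ∀ w, m ≤ ht w → y w = 0
  have hp : ∃ m, p m := by
    obtain ⟨y, hy, hy0⟩ := Submodule.exists_mem_ne_zero_of_ne_bot h0
    refine ⟨(Finset.univ.sup ht) + 1, y, hy, hy0, fun w hw => ?_⟩
    have := Finset.le_sup (f := ht) (Finset.mem_univ w)
    omega
  obtain ⟨y, hy, hy0, hw⟩ := Nat.find_spec hp
  refine ⟨y, hy, hy0, fun a b hab => ?_⟩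
  by_contra hne
  have hpos : 0 < Nat.find hp := by
    rcases Nat.eq_zero_or_pos (Nat.find hp) with h | h
    · rw [h] at hw
      exact absurd (funext fun w => hw w (Nat.zero_le _)) hy0
    · exact h
  refine Nat.find_min hp (Nat.sub_lt hpos one_pos) ⟨_, hS a b hab y hy, hne, fun w hm => ?_⟩
  rw [low, LinearMap.sum_apply, Finset.sum_apply]
  refine Finset.sum_eq_zero fun j hj => ?_
  rw [slot_apply]
  split_ifs with hwj
  · refine hw _ ?_
    have h1 : ht (Function.update w j b) + w j = ht w + b := by
      simp only [ht]
      rw [← Finset.add_sum_erase _ _ hj, ← Finset.add_sum_erase (below n k) (fun j => (w j : ℕ)) hj]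
      have : ∑ l ∈ (below n k).erase j, ((Function.update w j b l : Fin N) : ℕ) =
          ∑ l ∈ (below n k).erase j, (w l : ℕ) :=
        Finset.sum_congr rfl fun l hl => by rw [Function.update_of_ne (Finset.ne_of_mem_erase hl)]
      rw [this, Function.update_self]
      omega
    have h2 : (a : ℕ) < b := hab
    rw [hwj] at h1
    omega
  · rfl

/-- The standard Hermitian form. -/
def herm (f g : WordFn n N) : ℂ := ∑ w, star (f w) * g w

open scoped ComplexOrder in
theorem herm_self_eq_zero {f : WordFn n N} (h : herm f f = 0) : f = 0 :=
  dotProduct_self_star_eq_zero.mp ((dotProduct_comm _ _).trans h)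

theorem herm_add_left (f g h : WordFn n N) : herm (f + g) h = herm f h + herm g h := by
  simp [herm, add_mul, Finset.sum_add_distrib]

theorem herm_add_right (f g h : WordFn n N) : herm f (g + h) = herm f g + herm f h := by
  simp [herm, mul_add, Finset.sum_add_distrib]

theorem herm_smul_left (c : ℂ) (f g : WordFn n N) : herm (c • f) g = star c * herm f g := by
  simp [herm, Finset.mul_sum, mul_assoc]

theorem herm_smul_right (c : ℂ) (f g : WordFn n N) : herm f (c • g) = c * herm f g := by
  simp only [herm, Finset.mul_sum, Pi.smul_apply, smul_eq_mul]
  exact Finset.sum_congr rfl fun w _ => by ring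

theorem herm_zero_left (f : WordFn n N) : herm 0 f = 0 := by simp [herm]

theorem herm_zero_right (f : WordFn n N) : herm f 0 = 0 := by simp [herm]

theorem herm_permAct (σ : Equiv.Perm (Fin n)) (f g : WordFn n N) :
    herm (permAct n N σ f) g = herm f (permAct n N σ⁻¹ g) := by
  refine Fintype.sum_equiv (Equiv.arrowCongr σ.symm (Equiv.refl (Fin N))) _ _ fun w => ?_
  have h1 : (Equiv.arrowCongr σ.symm (Equiv.refl (Fin N))) w = w ∘ σ := by
    ext i; simp [Equiv.arrowCongr]
  have h2 : (w ∘ σ) ∘ (σ⁻¹ : Equiv.Perm (Fin n)) = w := by ext i; simp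
  rw [h1, permAct_apply, permAct_apply, h2]

/-- Operators that are self-adjoint for the standard Hermitian form. -/
def IsHerm (T : Module.End ℂ (WordFn n N)) : Prop := ∀ f g, herm (T f) g = herm f (T g)

theorem isHerm_jm (k : ℕ) (a : Fin n) : IsHerm (wordRep n N (jm k a)) := by
  intro f g
  rw [jm, map_sum, LinearMap.sum_apply, LinearMap.sum_apply]
  have h (j : Fin n) : herm (wordRep n N (tr j a) f) g = herm f (wordRep n N (tr j a) g) := by
    rw [tr, wordRep_of, herm_permAct, Equiv.swap_inv]
  induction below n k using Finset.induction_on with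
  | empty => simp [herm_zero_left, herm_zero_right]
  | insert j s hj ih => rw [Finset.sum_insert hj, Finset.sum_insert hj, herm_add_left,
      herm_add_right, ih, h]

theorem IsHerm.aeval_nodal {T : Module.End ℂ (WordFn n N)} (hT : IsHerm T) (s : Finset ℕ)
    {v : ℕ → ℂ} (hv : ∀ i, star (v i) = v i) :
    IsHerm (Polynomial.aeval T (Lagrange.nodal s v)) := by
  classical
  induction s using Finset.induction_on with
  | empty => intro f g; simp
  | insert i s hi ih =>
    intro f g
    -- Adjunction reverses products, so the factorisation is needed in both orders.
    have h1 : Polynomial.aeval T (Lagrange.nodal (insert i s) v) =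
        (T - algebraMap ℂ _ (v i)) * Polynomial.aeval T (Lagrange.nodal s v) := by
      rw [Lagrange.nodal_insert_eq_nodal hi]; simp
    have h2 : Polynomial.aeval T (Lagrange.nodal (insert i s) v) =
        Polynomial.aeval T (Lagrange.nodal s v) * (T - algebraMap ℂ _ (v i)) := by
      rw [Lagrange.nodal_insert_eq_nodal hi, mul_comm]; simp
    have h3 (f g : WordFn n N) : herm ((T - algebraMap ℂ _ (v i)) f) g =
        herm f ((T - algebraMap ℂ _ (v i)) g) := by
      simp only [sub_eq_add_neg, LinearMap.add_apply, LinearMap.neg_apply,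
        Module.algebraMap_end_apply, ← neg_smul, herm_add_left, herm_add_right, herm_smul_left,
        herm_smul_right, hT f g, star_neg, hv]
    nth_rw 1 [h1]
    rw [h2, Module.End.mul_apply, Module.End.mul_apply, h3, ih]

theorem herm_slot (i : Fin n) (a b : Fin N) (f g : WordFn n N) :
    herm (slot i a b f) g = herm f (slot i b a g) := by
  classical
  simp only [herm, slot_apply]
  have h1 : ∑ w : Fin n → Fin N, star (if w i = a then f (Function.update w i b) else 0) * g w =
      ∑ w with w i = a, star (f (Function.update w i b)) * g w := by
    rw [Finset.sum_filter]
    refine Finset.sum_congr rfl fun w _ => ?_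
    split_ifs <;> simp
  have h2 : ∑ w : Fin n → Fin N, star (f w) * (if w i = b then g (Function.update w i a) else 0) =
      ∑ w with w i = b, star (f w) * g (Function.update w i a) := by
    rw [Finset.sum_filter]
    refine Finset.sum_congr rfl fun w _ => ?_
    split_ifs <;> simp
  rw [h1, h2]
  refine Finset.sum_nbij' (fun w => Function.update w i b) (fun w => Function.update w i a) ?_ ?_ ?_
    ?_ ?_
  · intro w _; simp
  · intro w _; simp
  · intro w hw
    have : w i = a := by simpa using hw
    simp [← this]
  · intro w hw
    have : w i = b := by simpa using hw
    simp [← this]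
  · intro w hw
    have : w i = a := by simpa using hw
    simp [← this]

theorem herm_low (k : ℕ) (a b : Fin N) (f g : WordFn n N) :
    herm (low k a b f) g = herm f (low k b a g) := by
  rw [low, low, LinearMap.sum_apply, LinearMap.sum_apply]
  induction below n k using Finset.induction_on with
  | empty => simp [herm_zero_left, herm_zero_right]
  | insert j s hj ih => rw [Finset.sum_insert hj, Finset.sum_insert hj, herm_add_left,
      herm_add_right, ih, herm_slot]

end Words

/-! ### Singular vectors and the spectrum of the Jucys–Murphy elements -/

section Singular

variable {n N : ℕ} {r : Fin n → ℕ} {M : ℕ}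

theorem exists_top {k : Fin n} {y : WordFn n N} (hy : y ≠ 0) :
    ∃ i : Fin N, slot k i i y ≠ 0 ∧ ∀ j, i < j → slot k j j y = 0 := by
  classical
  have h1 : (Finset.univ.filter fun i : Fin N => slot k i i y ≠ 0).Nonempty := by
    by_contra h
    rw [Finset.not_nonempty_iff_eq_empty, Finset.filter_eq_empty_iff] at h
    apply hy
    have := congrArg (fun T : Module.End ℂ (WordFn n N) => T y) (sum_slot (n := n) (N := N) k)
    simp only [LinearMap.sum_apply, Module.End.one_apply] at this
    rw [← this]
    exact Finset.sum_eq_zero fun i hi => not_not.mp (h hi)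
  refine ⟨Finset.max' _ h1, (Finset.mem_filter.mp (Finset.max'_mem _ h1)).2, fun j hj => ?_⟩
  by_contra h
  exact absurd (Finset.le_max' _ j (Finset.mem_filter.mpr ⟨Finset.mem_univ j, h⟩)) (not_le.mpr hj)

theorem IsSing.low_apply {k : Fin n} {y : WordFn n N} (hy : IsSing (k + 1) y) {a b : Fin N}
    (hab : a < b) : low k a b y = -slot k a b y := by
  have := hy a b hab
  rw [low_succ, LinearMap.add_apply] at this
  exact eq_neg_of_add_eq_zero_left this

theorem slot_apply_eq_zero {k : Fin n} {y : WordFn n N} {b : Fin N} (h : slot k b b y = 0)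
    (a : Fin N) : slot k a b y = 0 := by
  rw [← slot_mul_slot k a b b, Module.End.mul_apply, h, map_zero]

/-- The top component of a singular vector is singular. -/
theorem IsSing.top {k : Fin n} {y : WordFn n N} (hy : IsSing (k + 1) y) {i : Fin N}
    (hi : ∀ j, i < j → slot k j j y = 0) : IsSing k (slot k i i y) := by
  intro a b hab
  rw [← Module.End.mul_apply, (low_commute_slot le_rfl a b i i).eq, Module.End.mul_apply,
    hy.low_apply hab, map_neg, neg_eq_zero, ← Module.End.mul_apply]
  by_cases h : i = a
  · subst h
    rw [slot_mul_slot]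
    exact slot_apply_eq_zero (hi b hab) _
  · rw [slot_mul_slot_of_ne _ h, LinearMap.zero_apply]

theorem slot_mul_wordRep_jm (k : Fin n) (j : Fin N) :
    slot k j j * wordRep n N (jm k k) = ∑ a, low k a j * slot k j a := by
  rw [wordRep_jm, Finset.mul_sum]
  refine Finset.sum_congr rfl fun a _ => ?_
  rw [Finset.mul_sum, Finset.sum_eq_single j]
  · rw [← mul_assoc, ← (low_commute_slot le_rfl a j j j).eq, mul_assoc, slot_mul_slot]
  · intro b _ hb
    rw [← mul_assoc, ← (low_commute_slot le_rfl a b j j).eq, mul_assoc,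
      slot_mul_slot_of_ne _ hb.symm, mul_zero]
  · simp

/-- The top component of the image of a singular vector under the Jucys–Murphy element. -/
theorem IsSing.slot_jm {k : Fin n} {y : WordFn n N} (hy : IsSing (k + 1) y) {j : Fin N}
    (hj : ∀ a, j < a → slot k a a y = 0) :
    slot k j j (wordRep n N (jm k k) y) =
      low k j j (slot k j j y) - (j : ℂ) • slot k j j y := by
  rw [← Module.End.mul_apply, slot_mul_wordRep_jm, LinearMap.sum_apply]
  -- Terms with `a > j` vanish since `j` bounds the last letter. For `a < j`, singularity replaces
  -- `low k a j` by `-slot k a j`, and each of these `j` terms contributes `-slot k j j y`.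
  have h1 (a : Fin N) : (low k a j * slot k j a : Module.End ℂ (WordFn n N)) y = (if a = j then low k j j (slot k j j y) else 0) +
      if a < j then -slot k j j y else 0 := by
    rcases lt_trichotomy a j with h | h | h
    · rw [if_neg h.ne, if_pos h, zero_add, (low_commute_slot le_rfl a j j a).eq,
        Module.End.mul_apply, hy.low_apply h, map_neg, ← Module.End.mul_apply, slot_mul_slot]
    · subst h
      simp [Module.End.mul_apply]
    · rw [if_neg h.ne', if_neg (not_lt.mpr h.le), add_zero, Module.End.mul_apply,
        slot_apply_eq_zero (hj a h), map_zero]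
  simp only [h1]
  rw [Finset.sum_add_distrib, Finset.sum_ite_eq' Finset.univ j, if_pos (Finset.mem_univ j),
    ← Finset.sum_filter, Finset.sum_const]
  have h2 : (Finset.univ.filter fun a : Fin N => a < j).card = (j : ℕ) := by
    rw [show (Finset.univ.filter fun a : Fin N => a < j) = Finset.Iio j by ext; simp, Fin.card_Iio]
  rw [h2, sub_eq_add_neg, smul_neg, Nat.cast_smul_eq_nsmul]

theorem isSing_of_commute {k : ℕ} {y : WordFn n N} (hy : IsSing k y)
    {T : Module.End ℂ (WordFn n N)} (hT : ∀ a b, Commute T (low k a b)) : IsSing k (T y) := by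
  intro a b hab
  rw [← Module.End.mul_apply, ← (hT a b).eq, Module.End.mul_apply, hy a b hab, map_zero]

theorem isSing_sub {k : ℕ} {y z : WordFn n N} (hy : IsSing k y) (hz : IsSing k z) :
    IsSing k (y - z) := by
  intro a b hab
  rw [map_sub, hy a b hab, hz a b hab, sub_zero]

theorem isSing_smul {k : ℕ} {y : WordFn n N} (c : ℂ) (hy : IsSing k y) : IsSing k (c • y) := by
  intro a b hab
  rw [map_smul, hy a b hab, smul_zero]

/-- The range of the fused element on functions of words. -/
def fusedRange (r : Fin n → ℕ) (M N k : ℕ) : Submodule ℂ (WordFn n N) :=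
  LinearMap.range (wordRep n N (fused r M k))

theorem mem_fusedRange_of_commute {k : ℕ} {T : Module.End ℂ (WordFn n N)}
    (hT : Commute T (wordRep n N (fused r M k))) {y : WordFn n N} (hy : y ∈ fusedRange r M N k) :
    T y ∈ fusedRange r M N k := by
  obtain ⟨z, rfl⟩ := hy
  exact ⟨T z, by rw [← Module.End.mul_apply, ← hT.eq, Module.End.mul_apply]⟩

theorem slot_mem_fusedRange {k : ℕ} {i : Fin n} (hi : k ≤ i) (a b : Fin N) {y : WordFn n N}
    (hy : y ∈ fusedRange r M N k) : slot i a b y ∈ fusedRange r M N k :=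
  mem_fusedRange_of_commute (wordRep_commute_slot (fused_mem_firstAlg r M k) hi a b).symm hy

theorem low_mem_fusedRange {k l : ℕ} (hl : k ≤ l) (a b : Fin N) {y : WordFn n N}
    (hy : y ∈ fusedRange r M N k) : low l a b y ∈ fusedRange r M N k :=
  mem_fusedRange_of_commute (wordRep_commute_low (fused_mem_firstAlg r M k) hl a b).symm hy

theorem jm_mem_fusedRange (k : Fin n) {y : WordFn n N} (hy : y ∈ fusedRange r M N k) :
    wordRep n N (jm k k) y ∈ fusedRange r M N k :=
  mem_fusedRange_of_commute ((commute_jm_fused r M k).map (wordRep n N)) hy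

theorem fusedRange_succ_le (k : Fin n) : fusedRange r M N (k + 1) ≤ fusedRange r M N k := by
  rintro _ ⟨z, rfl⟩
  have h : fused r M (k + 1) = fused r M k * fusedStep r M k := by
    have := congrArg (Polynomial.aeval (jm (k : ℕ) k))
      (Lagrange.basis (Finset.range M) (nextContent r k) (r k)).as_sum_range
    have hc : Commute (rowProj r M k (r k)) (fused r M k) := by
      rw [rowProj, this, map_sum]
      refine Commute.sum_left _ _ _ fun i _ => ?_
      rw [Polynomial.aeval_monomial]
      exact (Algebra.commute_algebraMap_left _ _).mul_left ((commute_jm_fused r M k).pow_left i)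
    rw [fused_succ]
    exact (hc.smul_left _).eq
  rw [h, map_mul, Module.End.mul_apply]
  exact ⟨_, rfl⟩

theorem jm_apply_of_mem (hM : ∀ i, r i < M) {k : Fin n} (h : NodalVanishing r M k)
    {y : WordFn n N} (hy : y ∈ fusedRange r M N (k + 1)) :
    wordRep n N (jm k k) y = rowContent r k • y := by
  obtain ⟨z, rfl⟩ := hy
  rw [← Module.End.mul_apply, ← map_mul, jm_mul_fused_succ hM h, map_smul, LinearMap.smul_apply]

/-- The singular vectors have the expected weight. -/
def SingWeight (r : Fin n → ℕ) (M N k : ℕ) : Prop :=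
  ∀ y ∈ fusedRange r M N k, IsSing k y → ∀ a : Fin N, low k a a y = (rowCount r k a : ℂ) • y

theorem slot_jm_sub_apply {k : Fin n} (hw : SingWeight r M N k) {y : WordFn n N}
    (hy : y ∈ fusedRange r M N k) (hs : IsSing (k + 1) y) {i : Fin N}
    (hi : ∀ j, i < j → slot k j j y = 0) :
    slot k i i (wordRep n N (jm k k) y) = nextContent r k i • slot k i i y := by
  rw [hs.slot_jm hi, hw _ (slot_mem_fusedRange le_rfl i i hy) (hs.top hi), ← sub_smul, nextContent]

/-- A non-zero singular vector has its top component in the row of the new node. -/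
theorem exists_top_eq (hr : IsLattice r) (hM : ∀ i, r i < M) {k : Fin n} (h : NodalVanishing r M k)
    (hw : SingWeight r M N k) {y : WordFn n N} (hy : y ∈ fusedRange r M N (k + 1))
    (hs : IsSing (k + 1) y) (h0 : y ≠ 0) :
    ∃ i : Fin N, (i : ℕ) = r k ∧ slot k i i y ≠ 0 ∧ ∀ j, i < j → slot k j j y = 0 := by
  obtain ⟨i, hi0, hi⟩ := exists_top (k := k) h0
  refine ⟨i, ?_, hi0, hi⟩
  have h1 := slot_jm_sub_apply hw (fusedRange_succ_le k hy) hs hi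
  rw [jm_apply_of_mem hM h hy, map_smul] at h1
  -- The top component is an eigenvector for the content of the new node and for `d_i`; the `d_i` of
  -- different rows differ.
  have h2 := smul_left_injective ℂ hi0 h1
  exact (hr.nextContent_injective k h2).symm

/-- The defect `E_{a,a} y - (rowCount) y` is again a singular vector of the image, so if nonzero its
top component lies in row `r k`. But that component vanishes: the top component of `y` has the
weight known for `k` nodes, and the last factor adds `1` exactly for `a = r k`. -/
theorem singWeight_succ (hr : IsLattice r) (hM : ∀ i, r i < M) {k : Fin n}
    (h : NodalVanishing r M k) (hw : SingWeight r M N k) : SingWeight r M N (k + 1) := by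
  intro y hy hs a
  by_contra hne
  have h0 : y ≠ 0 := by rintro rfl; simp at hne
  obtain ⟨i, hir, hi0, hi⟩ := exists_top_eq hr hM h hw hy hs h0
  have hs' : IsSing (k + 1) (low (k + 1) a a y) := by
    intro c d hcd
    rw [← Module.End.mul_apply, low_mul_low]
    simp only [LinearMap.sub_apply, LinearMap.add_apply, Module.End.mul_apply]
    rw [hs c d hcd, map_zero, zero_add]
    by_cases h1 : d = a
    · subst h1
      rw [if_pos rfl, if_neg hcd.ne', hs c d hcd, LinearMap.zero_apply, sub_zero]
    · rw [if_neg h1]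
      by_cases h2 : a = c
      · subst h2; rw [if_pos rfl, hs a d hcd, LinearMap.zero_apply, sub_zero]
      · rw [if_neg h2, LinearMap.zero_apply, sub_zero]
  obtain ⟨i', hir', hi0', -⟩ := exists_top_eq hr hM h hw
    (sub_mem (low_mem_fusedRange le_rfl a a hy) (Submodule.smul_mem _ (rowCount r (k + 1) a : ℂ) hy))
    (isSing_sub hs' (isSing_smul _ hs)) (sub_ne_zero.mpr hne)
  obtain rfl : i' = i := Fin.ext (hir'.trans hir.symm)
  apply hi0'
  rw [map_sub, map_smul, low_succ, LinearMap.add_apply, map_add, ← Module.End.mul_apply,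
    ← (low_commute_slot le_rfl a a i' i').eq, Module.End.mul_apply,
    hw _ (slot_mem_fusedRange le_rfl i' i' (fusedRange_succ_le k hy)) (hs.top hi)]
  by_cases hia : i' = a
  · subst hia
    rw [← Module.End.mul_apply, slot_mul_slot, hir, rowCount_succ_self]
    push_cast
    module
  · rw [← Module.End.mul_apply, slot_mul_slot_of_ne _ hia, rowCount_succ_of_ne, LinearMap.zero_apply,
      add_zero, sub_self]
    rw [← hir]
    exact fun h => hia (Fin.ext h)

theorem singWeight (hr : IsLattice r) (hM : ∀ i, r i < M) {k : ℕ} (hk : k ≤ n)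
    (h : ∀ j : Fin n, (j : ℕ) < k → NodalVanishing r M j) : SingWeight r M N k := by
  induction k with
  | zero => intro y _ _ a; simp [low, below_zero, rowCount_zero]
  | succ k ih =>
    exact singWeight_succ (k := ⟨k, hk⟩) hr hM (h ⟨k, hk⟩ (Nat.lt_succ_self k))
      (ih (by omega) fun j hj => h j (by omega))

/-- A singular vector is determined by its coefficients at the words that begin with the row
word. -/
theorem sing_eq_zero (hr : IsLattice r) (hM : ∀ i, r i < M) {k : ℕ} (hk : k ≤ n)
    (h : ∀ j : Fin n, (j : ℕ) < k → NodalVanishing r M j) {y : WordFn n N}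
    (hy : y ∈ fusedRange r M N k) (hs : IsSing k y)
    (h0 : ∀ w : Fin n → Fin N, (∀ j : Fin n, (j : ℕ) < k → (w j : ℕ) = r j) → y w = 0) : y = 0 := by
  induction k generalizing y with
  | zero => exact funext fun w => h0 w fun j hj => absurd hj (Nat.not_lt_zero _)
  | succ k ih =>
    obtain ⟨k, rfl⟩ : ∃ k' : Fin n, (k' : ℕ) = k := ⟨⟨k, by omega⟩, rfl⟩
    by_contra hne
    obtain ⟨i, hir, hi0, hi⟩ := exists_top_eq hr hM (h k (Nat.lt_succ_self _))
      (singWeight hr hM k.2.le fun j hj => h j (by omega)) hy hs hne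
    -- The top component is singular for the first `k` factors and lies in the previous image. It
    -- fixes the last letter to be `r k`, so the vanishing hypothesis passes down.
    refine hi0 (ih (by omega) (fun j hj => h j (by omega))
      (slot_mem_fusedRange le_rfl i i (fusedRange_succ_le k hy)) (hs.top hi) fun w hw => ?_)
    rw [slot_apply]
    split_ifs with hwi
    · rw [← hwi, Function.update_eq_self]
      refine h0 w fun j hj => ?_
      rcases Nat.lt_succ_iff_lt_or_eq.mp hj with h1 | h1
      · exact hw j h1
      · rw [Fin.ext h1, hwi, hir]
    · rfl

/-- By triangularity, `J_k - d_m` kills the component with last letter `m` and creates none with a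
larger letter. The result is again a singular vector of the image, with a smaller bound on its last
letter. -/
theorem aeval_nodal_apply_eq_zero {k : Fin n} (hw : SingWeight r M N k) (m : ℕ) {y : WordFn n N}
    (hy : y ∈ fusedRange r M N k) (hs : IsSing (k + 1) y)
    (hm : ∀ j : Fin N, m ≤ j → slot k j j y = 0) :
    Polynomial.aeval (wordRep n N (jm k k))
      (Lagrange.nodal (Finset.range m) (nextContent r k)) y = 0 := by
  induction m generalizing y with
  | zero =>
    have : y = 0 := by
      by_contra h
      obtain ⟨i, hi, -⟩ := exists_top (k := k) h
      exact hi (hm i (Nat.zero_le _))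
    rw [this, map_zero]
  | succ m ih =>
    set x := wordRep n N (jm k k) with hx
    have hz : Polynomial.aeval x (Lagrange.nodal (Finset.range m) (nextContent r k))
        (x y - nextContent r k m • y) = 0 := by
      refine ih (sub_mem (jm_mem_fusedRange k hy) (Submodule.smul_mem _ _ hy))
        (isSing_sub (isSing_of_commute hs fun a b => ?_) (isSing_smul _ hs)) fun j hj => ?_
      · exact wordRep_commute_low (jm_mem_firstAlg k) le_rfl a b
      · have hj' : ∀ a, j < a → slot k a a y = 0 := fun a ha => hm a (by
          have : (j : ℕ) < a := ha
          omega)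
        rw [map_sub, map_smul, hx, slot_jm_sub_apply hw hy hs hj']
        rcases Nat.eq_or_lt_of_le hj with h1 | h1
        · rw [← h1, sub_self]
        · rw [hm j h1, smul_zero, smul_zero, sub_zero]
    have h1 : Lagrange.nodal (Finset.range (m + 1)) (nextContent r k) =
        Lagrange.nodal (Finset.range m) (nextContent r k) *
          (Polynomial.X - Polynomial.C (nextContent r k m)) := by
      rw [Lagrange.nodal_eq, Lagrange.nodal_eq, Finset.prod_range_succ]
    rw [h1, map_mul, Module.End.mul_apply]
    simpa [Algebra.algebraMap_eq_smul_one] using hz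

/-- The Jucys–Murphy element satisfies the expected polynomial equation on the range of the
fused element. -/
theorem wordRep_nodal_mul_fused {k : Fin n} (hw : SingWeight r M N k) :
    Polynomial.aeval (wordRep n N (jm k k))
      (Lagrange.nodal (Finset.range N) (nextContent r k)) * wordRep n N (fused r M k) = 0 := by
  set x := wordRep n N (jm k k) with hx
  set p := Polynomial.aeval x (Lagrange.nodal (Finset.range N) (nextContent r k)) with hp
  have hpmap : p = wordRep n N (Polynomial.aeval (jm (k : ℕ) k)
      (Lagrange.nodal (Finset.range N) (nextContent r k))) := by
    rw [hp, hx, Polynomial.aeval_algHom_apply]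
  have hpmem : Polynomial.aeval (jm (k : ℕ) k)
      (Lagrange.nodal (Finset.range N) (nextContent r k)) ∈ firstAlg n (k + 1) := by
    have h := Polynomial.aeval_mem_adjoin_singleton ℂ (jm (k : ℕ) k)
      (p := Lagrange.nodal (Finset.range N) (nextContent r k))
    exact Algebra.adjoin_le (by simpa using jm_mem_firstAlg k) h
  have hpF : ∀ y ∈ fusedRange r M N k, p y ∈ fusedRange r M N k := by
    intro y hy
    rw [hp]
    generalize Lagrange.nodal (Finset.range N) (nextContent r k) = q
    induction q using Polynomial.induction_on with
    | C a => simpa [Algebra.algebraMap_eq_smul_one] using Submodule.smul_mem _ a hy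
    | add q q' h h' => simpa using add_mem h h'
    | monomial m a h =>
      rw [pow_succ', mul_left_comm, map_mul, Polynomial.aeval_X, Module.End.mul_apply]
      exact jm_mem_fusedRange k h
  have hherm : IsHerm p := (isHerm_jm k k).aeval_nodal _ fun i => by simp [nextContent]
  set S := (fusedRange r M N k).map p with hS
  by_cases hS0 : S = ⊥
  · refine LinearMap.ext fun z => ?_
    have : p (wordRep n N (fused r M k) z) ∈ S := Submodule.mem_map_of_mem ⟨z, rfl⟩
    rw [hS0, Submodule.mem_bot] at this
    rw [Module.End.mul_apply, this, LinearMap.zero_apply]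
  · exfalso
    obtain ⟨y, hyS, hy0, hs⟩ := exists_isSing (k := k + 1) (S := S) (by
      rintro a b - _ ⟨z, hz, rfl⟩
      have hc : Commute p (low (k + 1) a b) := by
        rw [hpmap]; exact wordRep_commute_low hpmem le_rfl a b
      refine ⟨low (k + 1) a b z, low_mem_fusedRange (Nat.le_succ _) a b hz, ?_⟩
      rw [← Module.End.mul_apply, hc.eq, Module.End.mul_apply]) hS0
    obtain ⟨z, hz, rfl⟩ := hyS
    apply hy0
    -- The vector `p z` is singular, hence killed by `p`, and self-adjointness gives `⟨p z, p z⟩ =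
    -- ⟨z, p (p z)⟩ = 0`.
    apply herm_self_eq_zero
    have h1 : p (p z) = 0 := aeval_nodal_apply_eq_zero hw N (hpF z hz) hs fun j hj => by
      have := j.2; omega
    rw [hherm, h1, herm_zero_right]

/-- A word with `n` distinct letters has pairwise different rearrangements, so the coefficient of
each permutation can be read off. -/
theorem wordRep_injective (h : n ≤ N) : Function.Injective (wordRep n N) := by
  rw [injective_iff_map_eq_zero]
  intro x hx
  ext σ
  have h1 := congrArg (fun T : Module.End ℂ (WordFn n N) =>
    T (Pi.single (fun i => Fin.castLE h (σ i)) 1) (Fin.castLE h)) hx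
  have h2 : ∀ x : SymAlg n, wordRep n N x (Pi.single (fun i => Fin.castLE h (σ i)) 1)
      (Fin.castLE h) = x.coeff σ := by
    intro x
    induction x using MonoidAlgebra.induction_on with
    | of τ =>
      rw [wordRep_of, permAct_apply, Pi.single_apply, MonoidAlgebra.of_apply,
        MonoidAlgebra.coeff_single, Finsupp.single_apply]
      congr 1
      rw [eq_iff_iff]
      constructor
      · intro h3
        ext i
        have := congrFun h3 i
        simpa using congrArg Fin.val this
      · rintro rfl; rfl
    | add x y hx hy => rw [map_add, LinearMap.add_apply, Pi.add_apply, hx, hy]; rfl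
    | smul c x hx => rw [map_smul, LinearMap.smul_apply, Pi.smul_apply, hx]; rfl
  rw [← h2]
  exact h1

/-- The induction alternates: vanishing for all `j < k` gives the weights of the singular vectors
after `k` nodes, and these give vanishing for `k`. It takes place on words in `M` letters, where the
group algebra acts faithfully. -/
theorem nodalVanishing (hr : IsLattice r) (hM : ∀ i, r i < M) (hn : n ≤ M) (k : Fin n) :
    NodalVanishing r M k := by
  obtain ⟨k, hk⟩ := k
  induction k using Nat.strong_induction_on with
  | _ k ih =>
    apply wordRep_injective hn
    rw [map_mul, map_zero, ← Polynomial.aeval_algHom_apply]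
    exact wordRep_nodal_mul_fused (k := ⟨k, hk⟩) (singWeight hr hM hk.le fun j hj => ih j hj j.2)

end Singular

/-! ### Nonvanishing of the fused element -/

section Coefficient

variable {n : ℕ}

/-- The span of the permutations with a given property, over the rational functions. -/
def permSpan (P : Equiv.Perm (Fin n) → Prop) : Submodule (RatFn n) (RatFn n ⊗[ℂ] SymAlg n) :=
  Submodule.span (RatFn n) {z | ∃ σ, P σ ∧ z = 1 ⊗ₜ[ℂ] MonoidAlgebra.of ℂ _ σ}

theorem permSpan_mono {P Q : Equiv.Perm (Fin n) → Prop} (h : ∀ σ, P σ → Q σ) :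
    permSpan P ≤ permSpan Q :=
  Submodule.span_mono fun _ ⟨σ, hσ, hz⟩ => ⟨σ, h σ hσ, hz⟩

theorem mul_mem_permSpan {P Q S : Equiv.Perm (Fin n) → Prop} (h : ∀ σ τ, P σ → Q τ → S (σ * τ))
    {x y : RatFn n ⊗[ℂ] SymAlg n} (hx : x ∈ permSpan P) (hy : y ∈ permSpan Q) :
    x * y ∈ permSpan S := by
  have h1 : permSpan P * permSpan Q ≤ permSpan S := by
    rw [permSpan, permSpan, Submodule.span_mul_span]
    refine Submodule.span_mono ?_
    rintro _ ⟨_, ⟨σ, hσ, rfl⟩, _, ⟨τ, hτ, rfl⟩, rfl⟩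
    refine ⟨σ * τ, h σ τ hσ hτ, ?_⟩
    simp only [Algebra.TensorProduct.tmul_mul_tmul, mul_one, map_mul]
  exact h1 (Submodule.mul_mem_mul hx hy)

theorem tmul_of_mem_permSpan {P : Equiv.Perm (Fin n) → Prop} {σ : Equiv.Perm (Fin n)} (h : P σ)
    (v : RatFn n) : v ⊗ₜ[ℂ] MonoidAlgebra.of ℂ _ σ ∈ permSpan P := by
  have : v ⊗ₜ[ℂ] MonoidAlgebra.of ℂ _ σ = v • ((1 : RatFn n) ⊗ₜ[ℂ] MonoidAlgebra.of ℂ _ σ) := by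
    rw [TensorProduct.smul_tmul', smul_eq_mul, mul_one]
  rw [this]
  exact Submodule.smul_mem _ _ (Submodule.subset_span ⟨σ, h, rfl⟩)

theorem one_mem_permSpan {P : Equiv.Perm (Fin n) → Prop} (h : P 1) : 1 ∈ permSpan P :=
  tmul_of_mem_permSpan h 1

/-- The coefficient of the identity permutation. -/
def coeffOne (n : ℕ) : SymAlg n →ₗ[ℂ] ℂ where
  toFun x := x.coeff 1
  map_add' _ _ := rfl
  map_smul' _ _ := rfl

theorem coeffOne_of (σ : Equiv.Perm (Fin n)) :
    coeffOne n (MonoidAlgebra.of ℂ _ σ) = if σ = 1 then 1 else 0 := by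
  change (MonoidAlgebra.of ℂ _ σ : SymAlg n).coeff 1 = _
  rw [MonoidAlgebra.of_apply, MonoidAlgebra.coeff_single, Finsupp.single_apply]

theorem ratMap_coeffOne_eq_zero {P : Equiv.Perm (Fin n) → Prop} (h : ∀ σ, P σ → σ ≠ 1)
    {x : RatFn n ⊗[ℂ] SymAlg n} (hx : x ∈ permSpan P) : ratMap (coeffOne n) x = 0 := by
  have h1 : permSpan P ≤ LinearMap.ker (ratMap (n := n) (coeffOne n)) := by
    refine Submodule.span_le.mpr ?_
    rintro _ ⟨σ, hσ, rfl⟩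
    change ratMap (coeffOne n) _ = 0
    rw [ratMap_tmul, coeffOne_of, if_neg (h σ hσ), TensorProduct.tmul_zero]
  exact h1 hx

theorem mul_one_sub_sub_one {R : Type*} [Ring R] (x y : R) :
    x * (1 - y) - 1 = (x - 1) - (x - 1) * y - y := by noncomm_ring

theorem mul_eq_add_mul_sub_one {R : Type*} [Ring R] (x y : R) : x * y = x + x * (y - 1) := by
  noncomm_ring

/-- Every nontrivial term is a product of transpositions `(i j)` with distinct increasing `i`. The
last of them sends `j` to its `i`, which the preceding ones fix, so `j` is moved. -/
theorem column_sub_one_mem (c : Fin n → ℂ) (m : ℕ) (j : Fin n) :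
    column c m j - 1 ∈ permSpan fun τ => τ j ≠ j ∧ ∀ i, j < i → τ i = i := by
  have key : ∀ t : ℕ, t ≤ j →
      (((List.finRange n).filter fun i : Fin n => (i : ℕ) < t).map fun i : Fin n =>
        1 - (algebraMap (Poly n) (RatFn n) (specVar c m i) - ratVar j)⁻¹ ⊗ₜ[ℂ] tr i j).prod - 1 ∈
      permSpan fun τ : Equiv.Perm (Fin n) => (τ j : ℕ) < t ∧ ∀ i : Fin n, t ≤ i → i ≠ j → τ i = i := by
    intro t ht
    induction t with
    | zero => simp
    | succ t ih =>
      obtain ⟨t, rfl⟩ : ∃ t' : Fin n, (t' : ℕ) = t := ⟨⟨t, by omega⟩, rfl⟩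
      have htj : t ≠ j := by rintro rfl; omega
      rw [filter_lt_succ, List.map_append, List.prod_append]
      set B := (((List.finRange n).filter fun i : Fin n => (i : ℕ) < t).map fun i : Fin n =>
        1 - (algebraMap (Poly n) (RatFn n) (specVar c m i) - ratVar j)⁻¹ ⊗ₜ[ℂ] tr i j).prod
      set v := (algebraMap (Poly n) (RatFn n) (specVar c m t) - ratVar j)⁻¹
      simp only [List.map_cons, List.map_nil, List.prod_cons, List.prod_nil, mul_one]
      specialize ih (by omega)
      have h3 : v ⊗ₜ[ℂ] tr t j ∈ permSpan fun τ : Equiv.Perm (Fin n) => τ = Equiv.swap t j := by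
        rw [tr]
        exact tmul_of_mem_permSpan (P := fun τ : Equiv.Perm (Fin n) => τ = Equiv.swap t j) rfl v
      rw [mul_one_sub_sub_one]
      generalize v ⊗ₜ[ℂ] tr t j = T at h3 ⊢
      refine sub_mem (sub_mem ?_ ?_) ?_
      · refine permSpan_mono ?_ ih
        rintro τ ⟨h1, h2⟩
        exact ⟨by omega, fun i hi hij => h2 i (by omega) hij⟩
      · refine mul_mem_permSpan ?_ ih h3
        rintro σ _ ⟨h1, h2⟩ rfl
        refine ⟨?_, fun i hi hij => ?_⟩
        · rw [Equiv.Perm.mul_apply, Equiv.swap_apply_right, h2 t le_rfl htj]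
          omega
        · rw [Equiv.Perm.mul_apply, Equiv.swap_apply_of_ne_of_ne _ hij, h2 i (by omega) hij]
          rintro rfl; omega
      · refine permSpan_mono ?_ h3
        rintro _ rfl
        refine ⟨?_, fun i hi hij => ?_⟩
        · rw [Equiv.swap_apply_right]; omega
        · rw [Equiv.swap_apply_of_ne_of_ne _ hij]
          rintro rfl; omega
  refine permSpan_mono ?_ (key j le_rfl)
  rintro τ ⟨h1, h2⟩
  refine ⟨fun h => ?_, fun i hi => h2 i (Fin.le_def.mp hi.le) hi.ne'⟩
  rw [h] at h1
  exact lt_irrefl _ h1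

/-- The coefficient of the identity in the fusion product is one. -/
theorem ratMap_coeffOne_symF : ratMap (coeffOne n) (symF n) = 1 ⊗ₜ[ℂ] (1 : ℂ) := by
  rw [symF_eq_prod_column 0]
  have key : ∀ t : ℕ, t ≤ n →
      (((List.finRange n).filter fun i : Fin n => (i : ℕ) < t).map (column 0 0)).prod ∈
        permSpan (fun τ : Equiv.Perm (Fin n) => ∀ i : Fin n, t ≤ i → τ i = i) ∧
      ratMap (coeffOne n) (((List.finRange n).filter fun i : Fin n => (i : ℕ) < t).map
        (column 0 0)).prod = 1 ⊗ₜ[ℂ] (1 : ℂ) := by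
    intro t ht
    induction t with
    | zero =>
      have h : (List.finRange n).filter (fun i : Fin n => (i : ℕ) < 0) = [] := by
        rw [List.filter_eq_nil_iff]; simp
      rw [h, List.map_nil, List.prod_nil]
      refine ⟨one_mem_permSpan fun i _ => rfl, ?_⟩
      rw [Algebra.TensorProduct.one_def, ratMap_tmul, ← map_one (MonoidAlgebra.of ℂ _), coeffOne_of,
        if_pos rfl]
    | succ t ih =>
      obtain ⟨t, rfl⟩ : ∃ t' : Fin n, (t' : ℕ) = t := ⟨⟨t, by omega⟩, rfl⟩
      obtain ⟨h1, h2⟩ := ih (by omega)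
      rw [filter_lt_succ, List.map_append, List.prod_append]
      set B := (((List.finRange n).filter fun i : Fin n => (i : ℕ) < t).map (column 0 0)).prod
      simp only [List.map_cons, List.map_nil, List.prod_cons, List.prod_nil, mul_one]
      have h3 := column_sub_one_mem (0 : Fin n → ℂ) 0 t
      rw [mul_eq_add_mul_sub_one, map_add, h2]
      refine ⟨add_mem (permSpan_mono (fun σ hσ i hi => hσ i (by omega)) h1)
        (mul_mem_permSpan ?_ h1 h3), ?_⟩
      · rintro σ τ hσ ⟨-, hτ⟩ i hi
        rw [Equiv.Perm.mul_apply, hτ i (Fin.lt_def.mpr (by omega)), hσ i (by omega)]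
      · rw [ratMap_coeffOne_eq_zero (P := fun σ : Equiv.Perm (Fin n) => σ ≠ 1) (fun _ h => h)
          (mul_mem_permSpan ?_ h1 h3), add_zero]
        -- Here `σ` fixes `t` and `τ` does not, so `σ * τ` cannot be the identity.
        rintro σ τ hσ ⟨hτ, -⟩ h
        apply hτ
        apply σ.injective
        rw [← Equiv.Perm.mul_apply, h, hσ t le_rfl, Equiv.Perm.one_apply]
  have h := (key n le_rfl).2
  have h1 : (List.finRange n).filter (fun i : Fin n => (i : ℕ) < n) = List.finRange n := by
    rw [List.filter_eq_self]; simp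
  rwa [h1] at h

/-- Evaluation commutes with taking the coefficient of the identity, which is the constant `1` in
the fusion product and hence `1` in its evaluation. -/
theorem fused_ne_zero {r : Fin n → ℕ} {M : ℕ} (hr : IsLattice r) (hM : ∀ i, r i < M)
    (hp : ∀ k, NodalVanishing r M k) : fused r M n ≠ 0 := by
  intro h
  have h1 := (isConsecutiveEval_symF hr hM hp).map (coeffOne n)
  rw [ratMap_coeffOne_symF] at h1
  have h2 := h1.unique (isConsecutiveEval_const _ 1)
  rw [h, map_zero] at h2
  exact zero_ne_one h2

/-- The fused element does not vanish on functions of words, if the letters suffice for all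
rows. -/
theorem wordRep_fused_ne_zero {r : Fin n → ℕ} {M N : ℕ} (hr : IsLattice r) (hM : ∀ i, r i < M)
    (hn : n ≤ M) (hN : ∀ i, r i < N) (hNM : N ≤ M) : wordRep n N (fused r M n) ≠ 0 := by
  intro h0
  have hp := nodalVanishing hr hM hn
  have hne : fusedRange r M M n ≠ ⊥ := by
    intro h
    rw [fusedRange, LinearMap.range_eq_bot] at h
    exact fused_ne_zero hr hM hp (wordRep_injective hn (h.trans (map_zero _).symm))
  obtain ⟨y, hy, hy0, hs⟩ := exists_isSing (k := n)
    (fun a b _ y hy => low_mem_fusedRange le_rfl a b hy) hne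
  have hw := singWeight hr hM le_rfl (fun j _ => hp j) y hy hs
  -- Restriction to words in the first `N` letters commutes with permutations, so the restriction of
  -- `y` is in the image of the operator assumed to be zero.
  let res : WordFn n M →ₗ[ℂ] WordFn n N := LinearMap.funLeft ℂ ℂ fun w i => Fin.castLE hNM (w i)
  have hres (x : SymAlg n) (f : WordFn n M) : res (wordRep n M x f) = wordRep n N x (res f) := by
    induction x using MonoidAlgebra.induction_on with
    | of σ => rw [wordRep_of, wordRep_of]; rfl
    | add x y hx hy => simp only [map_add, LinearMap.add_apply, hx, hy]
    | smul c x hx => simp only [map_smul, LinearMap.smul_apply, hx]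
  obtain ⟨z, rfl⟩ := hy
  apply hy0
  funext w
  -- A letter not less than `N` has weight `0` in `y`, as no row has that index. Hence `y` vanishes
  -- on words that contain such a letter.
  by_cases hw' : ∃ j, N ≤ (w j : ℕ)
  · obtain ⟨j, hj⟩ := hw'
    have h1 := congrFun (hw (w j)) w
    have h2 : rowCount r n (w j) = 0 := by
      rw [rowCount, Finset.card_eq_zero, Finset.filter_eq_empty_iff]
      intro i _ hi
      have := hN i
      omega
    rw [h2, Nat.cast_zero, zero_smul, low, LinearMap.sum_apply, Finset.sum_apply] at h1
    set y := wordRep n M (fused r M n) z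
    have h3 : ∀ i ∈ below n n, slot i (w j) (w j) y w = if w i = w j then y w else 0 := by
      intro i _
      rw [slot_apply]
      split_ifs with h
      · rw [← h, Function.update_eq_self]
      · rfl
    rw [Finset.sum_congr rfl h3, ← Finset.sum_filter, Finset.sum_const, Pi.zero_apply,
      smul_eq_zero, Finset.card_eq_zero] at h1
    rcases h1 with h1 | h1
    · have : j ∈ (∅ : Finset (Fin n)) := by rw [← h1]; simp
      simp at this
    · exact h1
  · push Not at hw'
    have h1 := congrFun (hres (fused r M n) z) fun j => ⟨w j, hw' j⟩
    rw [h0, LinearMap.zero_apply] at h1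
    exact h1

end Coefficient

/-! ### Row words of standard Young tableaux -/

section Tableau

variable {n : ℕ} {μ : YoungDiagram}

/-- The row of an entry of a tableau. -/
def StandardYoungTableau.rowOf (T : StandardYoungTableau n μ) (k : Fin n) : ℕ := (T.node k).1.1

/-- The column of an entry of a tableau. -/
def StandardYoungTableau.colOf (T : StandardYoungTableau n μ) (k : Fin n) : ℕ := (T.node k).1.2

theorem StandardYoungTableau.mem (T : StandardYoungTableau n μ) (k : Fin n) :
    (T.rowOf k, T.colOf k) ∈ μ := (T.node k).2

theorem StandardYoungTableau.eq_of_rowOf_eq (T : StandardYoungTableau n μ) {j k : Fin n}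
    (h1 : T.rowOf j = T.rowOf k) (h2 : T.colOf j = T.colOf k) : j = k :=
  T.node.injective (Subtype.ext (Prod.ext h1 h2))

theorem StandardYoungTableau.exists_entry (T : StandardYoungTableau n μ) {i c : ℕ}
    (h : (i, c) ∈ μ) : ∃ j, T.rowOf j = i ∧ T.colOf j = c :=
  ⟨T.node.symm ⟨(i, c), h⟩, by simp [rowOf], by simp [colOf]⟩

theorem StandardYoungTableau.le_of_le (T : StandardYoungTableau n μ) {j k : Fin n}
    (h1 : T.rowOf j ≤ T.rowOf k) (h2 : T.colOf j ≤ T.colOf k) : j ≤ k := T.standard j k h1 h2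

theorem StandardYoungTableau.rowCount_self (T : StandardYoungTableau n μ) (k : Fin n) :
    rowCount T.rowOf k (T.rowOf k) = T.colOf k := by
  rw [rowCount, ← Finset.card_range (T.colOf k)]
  refine Finset.card_nbij T.colOf ?_ ?_ ?_
  · intro j hj
    simp only [Finset.coe_filter, mem_below, Set.mem_ofPred_eq, Finset.coe_range,
      Set.mem_Iio] at hj ⊢
    by_contra h
    have := Fin.le_def.mp (T.le_of_le hj.2.ge (not_lt.mp h))
    omega
  · intro j hj l hl h
    simp only [Finset.coe_filter, mem_below, Set.mem_ofPred_eq] at hj hl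
    exact T.eq_of_rowOf_eq (hj.2.trans hl.2.symm) h
  · intro c hc
    simp only [Finset.coe_range, Set.mem_Iio] at hc
    obtain ⟨j, hj1, hj2⟩ := T.exists_entry (μ.up_left_mem le_rfl hc.le (T.mem k))
    refine ⟨j, ?_, hj2⟩
    simp only [Finset.coe_filter, mem_below, Set.mem_ofPred_eq]
    refine ⟨lt_of_le_of_ne (T.le_of_le hj1.le (hj2.le.trans hc.le)) ?_, hj1⟩
    intro h
    rw [← Fin.ext h, hj2] at hc
    exact lt_irrefl _ hc

theorem StandardYoungTableau.isLattice (T : StandardYoungTableau n μ) : IsLattice T.rowOf where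
  antitone k i i' hi := by
    -- Each entry of the lower row is sent to the entry above it in row `i`, which is no larger and
    -- so also among the first `k`.
    have h : ∀ j : Fin n, T.rowOf j = i' → ∃ l, T.rowOf l = i ∧ T.colOf l = T.colOf j := by
      intro j hj
      exact T.exists_entry (μ.up_left_mem (hj ▸ hi) le_rfl (T.mem j))
    choose! f hf1 hf2 using h
    refine Finset.card_le_card_of_injOn f ?_ ?_
    · intro j hj
      simp only [Finset.coe_filter, mem_below, Set.mem_ofPred_eq] at hj ⊢
      refine ⟨?_, hf1 j hj.2⟩
      have := Fin.le_def.mp (T.le_of_le (j := f j) (k := j) (by rw [hf1 j hj.2, hj.2]; exact hi)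
        (hf2 j hj.2).le)
      omega
    · intro j hj l hl h
      simp only [Finset.coe_filter, mem_below, Set.mem_ofPred_eq] at hj hl
      refine T.eq_of_rowOf_eq (hj.2.trans hl.2.symm) ?_
      rw [← hf2 j hj.2, h, hf2 l hl.2]
  strict k i hi := by
    rw [T.rowCount_self, ← Nat.succ_le_iff, ← Nat.add_one, ← Finset.card_range (T.colOf k + 1)]
    -- The entries of row `i` in columns `0, …, colOf k` precede `k`. They are `colOf k + 1` in
    -- number, one more than the entries before `k` in its own row.
    have h : ∀ c : ℕ, c ≤ T.colOf k → ∃ l, T.rowOf l = i ∧ T.colOf l = c := by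
      intro c hc
      exact T.exists_entry (μ.up_left_mem hi.le hc (T.mem k))
    have : Nonempty (Fin n) := ⟨k⟩
    choose! f hf1 hf2 using h
    refine Finset.card_le_card_of_injOn f ?_ ?_
    · intro c hc
      simp only [Finset.coe_range, Set.mem_Iio] at hc
      have hc' : c ≤ T.colOf k := by omega
      simp only [Finset.coe_filter, mem_below, Set.mem_ofPred_eq]
      refine ⟨lt_of_le_of_ne (T.le_of_le ((hf1 c hc').le.trans hi.le) ((hf2 c hc').le.trans hc')) ?_,
        hf1 c hc'⟩
      intro h
      have := hf1 c hc'
      rw [Fin.ext h] at this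
      omega
    · intro c hc d hd h
      simp only [Finset.coe_range, Set.mem_Iio] at hc hd
      rw [← hf2 c (by omega), h, hf2 d (by omega)]

theorem StandardYoungTableau.rowCount_eq_rowLen (T : StandardYoungTableau n μ) (i : ℕ) :
    rowCount T.rowOf n i = μ.rowLen i := by
  rw [rowCount, YoungDiagram.rowLen_eq_card]
  refine Finset.card_nbij (fun j => (T.rowOf j, T.colOf j)) ?_ ?_ ?_
  · intro j hj
    simp only [Finset.coe_filter, mem_below, Set.mem_ofPred_eq] at hj
    simpa [YoungDiagram.mem_row_iff, hj.2] using hj.2 ▸ T.mem j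
  · intro j _ l _ h
    exact T.eq_of_rowOf_eq (congrArg Prod.fst h) (congrArg Prod.snd h)
  · rintro ⟨i', c⟩ hc
    rw [Finset.mem_coe, YoungDiagram.mem_row_iff] at hc
    obtain ⟨j, hj1, hj2⟩ := T.exists_entry hc.1
    refine ⟨j, ?_, Prod.ext hj1 hj2⟩
    simp only [Finset.coe_filter, mem_below, Set.mem_ofPred_eq]
    exact ⟨j.2, hj1.trans hc.2⟩

theorem StandardYoungTableau.rowOf_lt (T : StandardYoungTableau n μ) (k : Fin n) :
    T.rowOf k < μ.colLen 0 :=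
  YoungDiagram.mem_iff_lt_colLen.mp (μ.up_left_mem le_rfl (Nat.zero_le _) (T.mem k))

theorem StandardYoungTableau.content_eq (T : StandardYoungTableau n μ) :
    T.content = rowContent T.rowOf := by
  funext k
  rw [rowContent, nextContent, T.rowCount_self]
  rfl

end Tableau

/-! ### Highest-weight modules over the enveloping algebra -/

section HighestWeightLemmas

attribute [local instance] LieRing.ofAssociativeRing

variable {V : Type*} [AddCommGroup V] [Module ℂ V] {N : ℕ}

/-- An element of `gl(V)` as an element of the enveloping algebra. -/
abbrev envel (g : Module.End ℂ V) : Ugl V := UniversalEnvelopingAlgebra.ι ℂ g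

theorem envel_mul (g h : Module.End ℂ V) :
    envel g * envel h = envel h * envel g + envel (g * h - h * g) := by
  have := LieHom.map_lie (UniversalEnvelopingAlgebra.ι ℂ (L := Module.End ℂ V)) g h
  rw [LieRing.of_associative_ring_bracket, LieRing.of_associative_ring_bracket] at this
  rw [envel, envel, envel, this]
  abel

/-- The elements with property `P` form a subalgebra containing the image of `gl(V)`. By the
universal property the identity factors through it. -/
theorem Ugl.induction {P : Ugl V → Prop} (h1 : ∀ c : ℂ, P (algebraMap ℂ (Ugl V) c))
    (h2 : ∀ g, P (envel g)) (h3 : ∀ x y, P x → P y → P (x * y)) (h4 : ∀ x y, P x → P y → P (x + y))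
    (x : Ugl V) : P x := by
  let S : Subalgebra ℂ (Ugl V) :=
    { carrier := {x | P x}
      mul_mem' := fun {x y} hx hy => h3 x y hx hy
      add_mem' := fun {x y} hx hy => h4 x y hx hy
      algebraMap_mem' := h1 }
  let f : Module.End ℂ V →ₗ⁅ℂ⁆ S :=
    { toFun := fun g => ⟨envel g, h2 g⟩
      map_add' := fun g h => Subtype.ext (map_add (UniversalEnvelopingAlgebra.ι ℂ (L := Module.End ℂ V)) g h)
      map_smul' := fun c g => Subtype.ext (map_smul (UniversalEnvelopingAlgebra.ι ℂ (L := Module.End ℂ V)) c g)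
      map_lie' := fun {g h} => Subtype.ext (by
        rw [LieRing.of_associative_ring_bracket (A := S)]
        exact (LieHom.map_lie (UniversalEnvelopingAlgebra.ι ℂ (L := Module.End ℂ V)) g h).trans
          (LieRing.of_associative_ring_bracket _ _)) }
  have h : (S.val.comp (UniversalEnvelopingAlgebra.lift ℂ f)) = AlgHom.id ℂ (Ugl V) := by
    apply UniversalEnvelopingAlgebra.hom_ext
    ext g
    change ((UniversalEnvelopingAlgebra.lift ℂ f (UniversalEnvelopingAlgebra.ι ℂ g) : S) : Ugl V) = _
    rw [UniversalEnvelopingAlgebra.lift_ι_apply]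
    rfl
  have h' := congrArg (fun F : Ugl V →ₐ[ℂ] Ugl V => F x) h
  have h'' : ((UniversalEnvelopingAlgebra.lift ℂ f x : S) : Ugl V) = x := h'
  rw [← h'']
  exact (UniversalEnvelopingAlgebra.lift ℂ f x).2

theorem toLin_single_mul (b : Module.Basis (Fin N) ℂ V) (i j k l : Fin N) :
    Matrix.toLin b b (Matrix.single i j (1 : ℂ)) * Matrix.toLin b b (Matrix.single k l 1) =
      if j = k then Matrix.toLin b b (Matrix.single i l 1) else 0 := by
  rw [Module.End.mul_eq_comp, ← Matrix.toLin_mul]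
  split_ifs with h
  · subst h; simp
  · simp [h]

theorem matUnit_mul (b : Module.Basis (Fin N) ℂ V) (i j k l : Fin N) :
    matUnit b i j * matUnit b k l = matUnit b k l * matUnit b i j +
      ((if j = k then matUnit b i l else 0) - if l = i then matUnit b k j else 0) := by
  unfold matUnit
  rw [envel_mul, toLin_single_mul, toLin_single_mul]
  refine congrArg _ ((map_sub (UniversalEnvelopingAlgebra.ι ℂ) _ _).trans ?_)
  congr 1
  · split_ifs
    · rfl
    · exact map_zero _
  · split_ifs
    · rfl
    · exact map_zero _

theorem envel_eq_sum (b : Module.Basis (Fin N) ℂ V) (g : Module.End ℂ V) :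
    envel g = ∑ i, ∑ j, LinearMap.toMatrix b b g i j • matUnit b i j := by
  have h : g = ∑ i, ∑ j, LinearMap.toMatrix b b g i j •
      Matrix.toLin b b (Matrix.single i j (1 : ℂ)) := by
    conv_lhs => rw [← Matrix.toLin_toMatrix b b g,
      Matrix.matrix_eq_sum_single (LinearMap.toMatrix b b g)]
    simp only [map_sum]
    refine Finset.sum_congr rfl fun i _ => Finset.sum_congr rfl fun j _ => ?_
    rw [← map_smul, Matrix.smul_single, smul_eq_mul, mul_one]
  conv_lhs => rw [h]
  simp only [envel, map_sum, map_smul, matUnit]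

/-- The grading element, normalised to annihilate a vector of weight `w`. -/
def gradingElt (b : Module.Basis (Fin N) ℂ V) (w : Fin N → ℂ) : Ugl V :=
  ∑ a : Fin N, (-(a : ℂ)) • (matUnit b a a - algebraMap ℂ (Ugl V) (w a))

theorem gradingElt_mul_matUnit (b : Module.Basis (Fin N) ℂ V) (w : Fin N → ℂ) (i j : Fin N) :
    gradingElt b w * matUnit b i j =
      matUnit b i j * gradingElt b w + ((j : ℂ) - i) • matUnit b i j := by
  have h (a : Fin N) : (-(a : ℂ)) • (matUnit b a a - algebraMap ℂ (Ugl V) (w a)) * matUnit b i j =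
      matUnit b i j * ((-(a : ℂ)) • (matUnit b a a - algebraMap ℂ (Ugl V) (w a))) +
      ((if a = j then (a : ℂ) • matUnit b i j else 0) -
        if a = i then (a : ℂ) • matUnit b i j else 0) := by
    rw [smul_mul_assoc, mul_smul_comm, sub_mul, mul_sub, matUnit_mul, Algebra.commutes]
    by_cases h1 : a = i
    · subst h1
      by_cases h2 : j = a
      · subst h2; simp
      · simp only [if_true, if_neg h2, if_neg (Ne.symm h2)]
        module
    · by_cases h2 : j = a
      · subst h2
        simp only [if_true, if_neg h1]
        module
      · simp only [if_neg h1, if_neg h2, if_neg (Ne.symm h2)]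
        module
  rw [gradingElt, Finset.sum_mul, Finset.sum_congr rfl fun a _ => h a, Finset.sum_add_distrib,
    Finset.mul_sum, Finset.sum_sub_distrib, Finset.sum_ite_eq' Finset.univ j,
    Finset.sum_ite_eq' Finset.univ i]
  simp only [Finset.mem_univ, if_true, sub_smul]

section Cyclic

variable {E : Type*} [AddCommGroup E] [Module ℂ E] [Module (Ugl V) E] [IsScalarTower ℂ (Ugl V) E]
  (b : Module.Basis (Fin N) ℂ V) (w : Fin N → ℂ)

/-- The span of the vectors whose degree is a negative integer. -/
def negPart (E : Type*) [AddCommGroup E] [Module ℂ E] [Module (Ugl V) E]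
    (b : Module.Basis (Fin N) ℂ V) (w : Fin N → ℂ) : Submodule ℂ E :=
  Submodule.span ℂ {x | ∃ m : ℕ, gradingElt b w • x = (-((m : ℂ) + 1)) • x}

/-- The product of the shifts of the grading element by `1, …, t`. -/
def shiftProd (b : Module.Basis (Fin N) ℂ V) (w : Fin N → ℂ) : ℕ → Ugl V
  | 0 => 1
  | t + 1 => (gradingElt b w + algebraMap ℂ (Ugl V) ((t : ℂ) + 1)) * shiftProd b w t

variable {b w}

theorem ugl_smul_smul (u : Ugl V) (c : ℂ) (x : E) : u • c • x = c • u • x := by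
  rw [← algebraMap_smul (Ugl V) c x, ← mul_smul, ← Algebra.commutes, mul_smul, algebraMap_smul]

theorem shiftProd_smul_of_eigen {x : E} {z : ℂ} (hx : gradingElt b w • x = z • x) (t : ℕ) :
    shiftProd b w t • x = (∏ m ∈ Finset.range t, (z + ((m : ℂ) + 1))) • x := by
  induction t with
  | zero => simp [shiftProd]
  | succ t ih =>
    rw [shiftProd, mul_smul, ih, ugl_smul_smul, add_smul, hx, algebraMap_smul, ← add_smul, smul_smul,
      Finset.prod_range_succ]

theorem exists_shiftProd_smul_eq_zero {x : E} (hx : x ∈ negPart E b w) :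
    ∃ t, ∀ s, t ≤ s → shiftProd b w s • x = 0 := by
  induction hx using Submodule.span_induction with
  | mem x hx =>
    obtain ⟨m, hm⟩ := hx
    refine ⟨m + 1, fun s hs => ?_⟩
    rw [shiftProd_smul_of_eigen hm, Finset.prod_eq_zero (Finset.mem_range.mpr hs) (by ring),
      zero_smul]
  | zero => exact ⟨0, fun s _ => smul_zero _⟩
  | add x y _ _ hx hy =>
    obtain ⟨t, ht⟩ := hx
    obtain ⟨t', ht'⟩ := hy
    exact ⟨max t t', fun s hs => by
      rw [smul_add, ht s (le_trans (le_max_left _ _) hs), ht' s (le_trans (le_max_right _ _) hs),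
        add_zero]⟩
  | smul c x _ hx =>
    obtain ⟨t, ht⟩ := hx
    exact ⟨t, fun s hs => by rw [ugl_smul_smul, ht s hs, smul_zero]⟩

theorem matUnit_smul_eigen {i j : Fin N} {x : E} {z : ℂ} (hx : gradingElt b w • x = z • x) :
    gradingElt b w • matUnit b i j • x = (z + ((j : ℂ) - i)) • matUnit b i j • x := by
  rw [← mul_smul, gradingElt_mul_matUnit, add_smul, mul_smul, hx, ugl_smul_smul, smul_assoc,
    ← add_smul]

theorem matUnit_smul_eigen_mem {i j : Fin N} (hij : j < i) {x : E} (m : ℕ)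
    (hx : gradingElt b w • x = (-(m : ℂ)) • x) : matUnit b i j • x ∈ negPart E b w := by
  have hij' : (j : ℕ) < i := hij
  obtain ⟨d, hd⟩ : ∃ d : ℕ, (i : ℕ) = j + 1 + d := ⟨i - j - 1, by omega⟩
  refine Submodule.subset_span ⟨m + d, ?_⟩
  rw [matUnit_smul_eigen hx, hd]
  push_cast
  congr 1
  ring

theorem matUnit_smul_mem_negPart {i j : Fin N} (hij : j < i) {x : E} (hx : x ∈ negPart E b w) :
    matUnit b i j • x ∈ negPart E b w := by
  induction hx using Submodule.span_induction with
  | mem x hx =>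
    obtain ⟨m, hm⟩ := hx
    refine matUnit_smul_eigen_mem hij (m + 1) ?_
    rw [hm]; push_cast; rfl
  | zero => rw [smul_zero]; exact zero_mem _
  | add x y _ _ hx hy => rw [smul_add]; exact add_mem hx hy
  | smul c x _ hx => rw [ugl_smul_smul]; exact Submodule.smul_mem _ c hx

/-- A vector that generates a highest-weight module of highest weight `w`. -/
structure IsHighest (b : Module.Basis (Fin N) ℂ V) (w : Fin N → ℂ) {E : Type*} [AddCommGroup E]
    [Module ℂ E] [Module (Ugl V) E] (v : E) : Prop where
  raise : ∀ i j, i < j → matUnit b i j • v = 0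
  weight : ∀ i, matUnit b i i • v = w i • v

theorem IsHighest.gradingElt_smul {v : E} (h : IsHighest b w v) : gradingElt b w • v = 0 := by
  rw [gradingElt, Finset.sum_smul]
  refine Finset.sum_eq_zero fun a _ => ?_
  rw [smul_assoc, sub_smul, h.weight, algebraMap_smul, sub_self, smul_zero]

/-- A stable subspace for the lowering operators that contains a highest-weight vector contains the
submodule which that vector generates. -/
theorem IsHighest.smul_mem {v : E} (h : IsHighest b w v) {L : Submodule ℂ E} (hv : v ∈ L)
    (hL : ∀ i j, j < i → ∀ x ∈ L, matUnit b i j • x ∈ L) (u : Ugl V) : u • v ∈ L := by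
  -- The smallest such subspace is shown to be stable under all of `gl(V)`; minimality takes the
  -- place of a Poincaré–Birkhoff–Witt argument.
  let L₀ : Submodule ℂ E := sInf {L | v ∈ L ∧ ∀ i j, j < i → ∀ x ∈ L, matUnit b i j • x ∈ L}
  have hv₀ : v ∈ L₀ := Submodule.mem_sInf.mpr fun L hL => hL.1
  have hL₀ : ∀ i j, j < i → ∀ x ∈ L₀, matUnit b i j • x ∈ L₀ := fun i j hij x hx =>
    Submodule.mem_sInf.mpr fun L hL => hL.2 i j hij x (Submodule.mem_sInf.mp hx L hL)
  -- The vectors that all of `gl(V)` keeps in `L₀`. By `g E x = E g x + [g, E] x` this set is stable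
  -- under lowering operators, and it contains `v`, so it is all of `L₀`.
  let Z : Submodule ℂ E :=
    { carrier := {x | x ∈ L₀ ∧ ∀ g : Module.End ℂ V, envel g • x ∈ L₀}
      add_mem' := fun {x y} hx hy => ⟨add_mem hx.1 hy.1, fun g => by
        rw [smul_add]; exact add_mem (hx.2 g) (hy.2 g)⟩
      zero_mem' := ⟨zero_mem _, fun g => by rw [smul_zero]; exact zero_mem _⟩
      smul_mem' := fun c x hx => ⟨Submodule.smul_mem _ c hx.1, fun g => by
        rw [ugl_smul_smul]; exact Submodule.smul_mem _ c (hx.2 g)⟩ }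
  have hZ : L₀ ≤ Z := by
    refine sInf_le ⟨⟨hv₀, fun g => ?_⟩, fun i j hij x hx => ⟨hL₀ i j hij x hx.1, fun g => ?_⟩⟩
    · rw [envel_eq_sum b, Finset.sum_smul]
      refine Submodule.sum_mem _ fun i _ => ?_
      rw [Finset.sum_smul]
      refine Submodule.sum_mem _ fun j _ => ?_
      rw [smul_assoc]
      refine Submodule.smul_mem _ _ ?_
      rcases lt_trichotomy i j with hij | hij | hij
      · rw [h.raise i j hij]; exact zero_mem _
      · subst hij; rw [h.weight]; exact Submodule.smul_mem _ _ hv₀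
      · exact hL₀ i j hij v hv₀
    · rw [← mul_smul, matUnit, envel_mul, add_smul, mul_smul]
      exact add_mem (hL₀ i j hij _ (hx.2 g)) (hx.2 _)
  have key : ∀ u : Ugl V, ∀ x ∈ L₀, u • x ∈ L₀ := by
    intro u
    induction u using Ugl.induction with
    | h1 c => intro x hx; rw [algebraMap_smul]; exact Submodule.smul_mem _ c hx
    | h2 g => intro x hx; exact (hZ hx).2 g
    | h3 u u' hu hu' => intro x hx; rw [mul_smul]; exact hu _ (hu' x hx)
    | h4 u u' hu hu' => intro x hx; rw [add_smul]; exact add_mem (hu x hx) (hu' x hx)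
  exact Submodule.mem_sInf.mp (key u v hv₀) L ⟨hv, hL⟩

/-- The module is the sum of the line of `v`, in degree `0`, and a part of negative degree. A proper
submodule lies in the negative part, hence so does the sum of all of them, and `v` is not in that
part. -/
theorem IsHighest.sSup_ne_top {v : E} (h : IsHighest b w v) (h0 : v ≠ 0)
    (hgen : ∀ x : E, ∃ u : Ugl V, x = u • v) :
    sSup {S : Submodule (Ugl V) E | S ≠ ⊤} ≠ ⊤ := by
  have hD : gradingElt b w • v = (0 : ℂ) • v := by rw [h.gradingElt_smul, zero_smul]
  have hdec : ∀ x : E, x ∈ Submodule.span ℂ {v} ⊔ negPart E b w := by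
    intro x
    obtain ⟨u, rfl⟩ := hgen x
    refine h.smul_mem (Submodule.mem_sup_left (Submodule.mem_span_singleton_self v)) ?_ u
    intro i j hij x hx
    obtain ⟨y, hy, z, hz, rfl⟩ := Submodule.mem_sup.mp hx
    obtain ⟨c, rfl⟩ := Submodule.mem_span_singleton.mp hy
    rw [smul_add, ugl_smul_smul]
    refine Submodule.mem_sup_right (add_mem (Submodule.smul_mem _ _ ?_)
      (matUnit_smul_mem_negPart hij hz))
    exact matUnit_smul_eigen_mem hij 0 (by rw [hD]; simp)
  have hprod (t : ℕ) : ∏ m ∈ Finset.range t, ((0 : ℂ) + ((m : ℂ) + 1)) ≠ 0 :=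
    Finset.prod_ne_zero_iff.mpr fun m _ => by
      rw [zero_add]; exact_mod_cast Nat.succ_ne_zero m
  have hsub : ∀ S : Submodule (Ugl V) E, S ≠ ⊤ → ∀ x ∈ S, x ∈ negPart E b w := by
    intro S hS x hx
    obtain ⟨y, hy, z, hz, rfl⟩ := Submodule.mem_sup.mp (hdec x)
    obtain ⟨c, rfl⟩ := Submodule.mem_span_singleton.mp hy
    obtain ⟨t, ht⟩ := exists_shiftProd_smul_eq_zero hz
    -- For large `t` the product of the shifts `1, …, t` of the grading element kills `z` and
    -- multiplies `v` by `t!`, so `v` would be in `S` if `c ≠ 0`.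
    have h1 : shiftProd b w t • (c • v + z) ∈ S := S.smul_mem _ hx
    rw [smul_add, ht t le_rfl, add_zero, ugl_smul_smul, shiftProd_smul_of_eigen hD, smul_smul] at h1
    by_cases hc : c = 0
    · rw [hc, zero_smul, zero_add]; exact hz
    · refine absurd (eq_top_iff.mpr fun x _ => ?_) hS
      have hv : v ∈ S := by
        have h2 := S.smul_mem (algebraMap ℂ (Ugl V) (c * ∏ m ∈ Finset.range t,
          ((0 : ℂ) + ((m : ℂ) + 1)))⁻¹) h1
        rwa [algebraMap_smul, inv_smul_smul₀ (mul_ne_zero hc (hprod t))] at h2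
      obtain ⟨u, rfl⟩ := hgen x
      exact S.smul_mem u hv
  intro htop
  have hall : ∀ x ∈ sSup {S : Submodule (Ugl V) E | S ≠ ⊤}, x ∈ negPart E b w := by
    intro x hx
    rw [sSup_eq_iSup'] at hx
    induction hx using Submodule.iSup_induction' with
    | mem S x hx => exact hsub S.1 S.2 x hx
    | zero => exact zero_mem _
    | add x y _ _ hx hy => exact add_mem hx hy
  have hv : v ∈ negPart E b w := hall v (by rw [htop]; exact Submodule.mem_top)
  obtain ⟨t, ht⟩ := exists_shiftProd_smul_eq_zero hv
  have := ht t le_rfl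
  rw [shiftProd_smul_of_eigen hD, smul_eq_zero] at this
  exact this.elim (hprod t) h0

end Cyclic

/-- A simple module with a highest-weight vector is the irreducible highest-weight module. -/
theorem nonempty_equiv_highestWeightModule (b : Module.Basis (Fin N) ℂ V) (w : Fin N → ℂ)
    {E : Type*} [AddCommGroup E] [Module (Ugl V) E] [IsSimpleModule (Ugl V) E] {v : E} (h0 : v ≠ 0)
    (h1 : ∀ i j, i < j → matUnit b i j • v = 0)
    (h2 : ∀ i, matUnit b i i • v = algebraMap ℂ (Ugl V) (w i) • v) :
    Nonempty (E ≃ₗ[Ugl V] HighestWeightModule b w) := by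
  have hle : vermaIdeal b w ≤ LinearMap.ker (LinearMap.toSpanSingleton (Ugl V) E v) := by
    refine Submodule.span_le.mpr ?_
    rintro x (⟨i, j, hij, rfl⟩ | ⟨i, rfl⟩)
    · simpa using h1 i j hij
    · simpa [sub_smul, sub_eq_zero] using h2 i
  let f : Verma b w →ₗ[Ugl V] E := (vermaIdeal b w).liftQ _ hle
  let v₀ : Verma b w := Submodule.Quotient.mk 1
  have hfv : f v₀ = v := by
    change (LinearMap.toSpanSingleton (Ugl V) E v) 1 = v
    simp
  have hsurj : Function.Surjective f := by
    rw [← LinearMap.range_eq_top]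
    refine (eq_bot_or_eq_top (LinearMap.range f)).resolve_left fun h => h0 ?_
    have : f v₀ ∈ LinearMap.range f := ⟨v₀, rfl⟩
    rwa [h, Submodule.mem_bot, hfv] at this
  have hv₀ : v₀ ≠ 0 := fun h => h0 (by rw [← hfv, h, map_zero])
  have hmk (u : Ugl V) : u • v₀ = Submodule.Quotient.mk u := by
    change Submodule.Quotient.mk (u • (1 : Ugl V)) = _
    rw [smul_eq_mul, mul_one]
  have hhigh : IsHighest b w v₀ := by
    constructor
    · intro i j hij
      rw [hmk, Submodule.Quotient.mk_eq_zero]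
      exact Submodule.subset_span (Or.inl ⟨i, j, hij, rfl⟩)
    · intro i
      rw [← algebraMap_smul (Ugl V), ← sub_eq_zero, ← sub_smul, hmk, Submodule.Quotient.mk_eq_zero]
      exact Submodule.subset_span (Or.inr ⟨i, rfl⟩)
  have hne := hhigh.sSup_ne_top hv₀ fun x => by
    obtain ⟨u, rfl⟩ := Submodule.Quotient.mk_surjective _ x
    exact ⟨u, (hmk u).symm⟩
  have hker : LinearMap.ker f ≠ ⊤ := fun h => h0 (by
    have : v₀ ∈ LinearMap.ker f := by rw [h]; exact Submodule.mem_top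
    rw [← hfv]; exact this)
  have hcoatom : IsCoatom (LinearMap.ker f) := by
    rw [← isSimpleModule_iff_isCoatom]
    exact IsSimpleModule.congr (f.quotKerEquivOfSurjective hsurj)
  -- The kernel is maximal because `E` is simple, and it lies in the sum of the proper submodules,
  -- which is itself proper.
  have heq : LinearMap.ker f = sSup {S : Submodule (Ugl V) (Verma b w) | S ≠ ⊤} := by
    have hle' : LinearMap.ker f ≤ sSup {S : Submodule (Ugl V) (Verma b w) | S ≠ ⊤} := le_sSup hker
    by_contra hne'
    exact hne (hcoatom.2 _ (lt_of_le_of_ne hle' hne'))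
  exact ⟨(f.quotKerEquivOfSurjective hsurj).symm.trans (Submodule.quotEquivOfEq _ _ heq)⟩

end HighestWeightLemmas

/-! ### Irreducibility by orthogonal complements -/

section Irreducible

variable {n N : ℕ}

theorem exists_sub_herm_eq_zero (S : Submodule ℂ (WordFn n N)) (w : WordFn n N) :
    ∃ p ∈ S, ∀ s ∈ S, herm s (w - p) = 0 := by
  let e := WithLp.linearEquiv 2 ℂ (WordFn n N)
  let S' : Submodule ℂ (EuclideanSpace ℂ (Fin n → Fin N)) := S.comap e.toLinearMap
  refine ⟨e (S'.starProjection (e.symm w)), S'.starProjection_apply_mem (e.symm w),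
    fun s hs => ?_⟩
  have h := S'.sub_starProjection_mem_orthogonal (e.symm w)
  have h1 := (Submodule.mem_orthogonal S' _).mp h (e.symm s) (by
    change e (e.symm s) ∈ S
    rwa [e.apply_symm_apply])
  rw [EuclideanSpace.inner_eq_star_dotProduct, dotProduct_comm] at h1
  exact h1

variable {r : Fin n → ℕ} {M : ℕ}

/-- The singular vectors of the range of the fused element are proportional to each other. -/
theorem exists_smul_eq_of_isSing (hr : IsLattice r) (hM : ∀ i, r i < M)
    (hp : ∀ k, NodalVanishing r M k) {y z : WordFn n N} (hy : y ∈ fusedRange r M N n)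
    (hz : z ∈ fusedRange r M N n) (hys : IsSing n y) (hzs : IsSing n z) (hy0 : y ≠ 0) :
    ∃ c : ℂ, z = c • y := by
  have hex : ∃ w : Fin n → Fin N, (∀ j, (w j : ℕ) = r j) ∧ y w ≠ 0 := by
    by_contra! h
    exact hy0 (sing_eq_zero hr hM le_rfl (fun j _ => hp j) hy hys fun w hw =>
      h w fun j => hw j j.2)
  obtain ⟨w, hw, hyw⟩ := hex
  refine ⟨z w / y w, sub_eq_zero.mp (sing_eq_zero hr hM le_rfl (fun j _ => hp j)
    (sub_mem hz (Submodule.smul_mem _ _ hy)) (isSing_sub hzs (isSing_smul _ hys)) fun w' hw' => ?_)⟩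
  obtain rfl : w' = w := funext fun j => Fin.ext ((hw' j j.2).trans (hw j).symm)
  simp [div_mul_cancel₀ _ hyw]

/-- The range of the fused element is irreducible under the action of the matrix units. -/
theorem fusedRange_eq_of_le (hr : IsLattice r) (hM : ∀ i, r i < M)
    (hp : ∀ k, NodalVanishing r M k) {S : Submodule ℂ (WordFn n N)} (hS : S ≤ fusedRange r M N n)
    (h0 : S ≠ ⊥) (hl : ∀ a b, ∀ y ∈ S, low n a b y ∈ S) : S = fusedRange r M N n := by
  refine le_antisymm hS fun w hw => ?_
  -- The orthogonal complement of `S` in the image, stable because `E_{a,b}` and `E_{b,a}` are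
  -- adjoint. If nonzero, it would contain a singular vector proportional to one in `S`, hence
  -- orthogonal to itself.
  let C : Submodule ℂ (WordFn n N) :=
    { carrier := {y | y ∈ fusedRange r M N n ∧ ∀ s ∈ S, herm s y = 0}
      add_mem' := fun {x y} hx hy => ⟨add_mem hx.1 hy.1, fun s hs => by
        rw [herm_add_right, hx.2 s hs, hy.2 s hs, add_zero]⟩
      zero_mem' := ⟨zero_mem _, fun s _ => herm_zero_right s⟩
      smul_mem' := fun c x hx => ⟨Submodule.smul_mem _ c hx.1, fun s hs => by
        rw [herm_smul_right, hx.2 s hs, mul_zero]⟩ }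
  have hC : C = ⊥ := by
    by_contra hne
    obtain ⟨y, hy, hy0, hys⟩ := exists_isSing (k := n) (fun a b _ => hl a b) h0
    obtain ⟨z, hz, hz0, hzs⟩ := exists_isSing (k := n) (S := C) (fun a b _ z hz =>
      ⟨low_mem_fusedRange le_rfl a b hz.1, fun s hs => by
        rw [← herm_low]; exact hz.2 _ (hl b a s hs)⟩) hne
    obtain ⟨c, rfl⟩ := exists_smul_eq_of_isSing hr hM hp (hS hy) hz.1 hys hzs hy0
    exact hz0 (herm_self_eq_zero (hz.2 _ (S.smul_mem c hy)))
  obtain ⟨p, hpS, hp'⟩ := exists_sub_herm_eq_zero S w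
  have : w - p ∈ C := ⟨sub_mem hw (hS hpS), hp'⟩
  rw [hC, Submodule.mem_bot, sub_eq_zero] at this
  exact this ▸ hpS

end Irreducible

/-! ### Transfer from words to tensors -/

section Coordinates

variable {V : Type*} [AddCommGroup V] [Module ℂ V] {N : ℕ} (n : ℕ) (b : Module.Basis (Fin N) ℂ V)

/-- The coordinates of tensors, as functions on words. -/
def coords : TPow n V ≃ₗ[ℂ] WordFn n N := (Basis.piTensorProduct fun _ : Fin n => b).equivFun

theorem coords_tprod (x : Fin n → V) (w : Fin n → Fin N) :
    coords n b (PiTensorProduct.tprod ℂ x) w = ∏ i, b.repr (x i) (w i) := by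
  rw [coords, Module.Basis.equivFun_apply, Basis.piTensorProduct_repr_tprod_apply]

variable {n}

theorem coords_permOp (i j : Fin n) (t : TPow n V) :
    coords n b (permOp V i j t) = permAct n N (Equiv.swap i j) (coords n b t) := by
  have : (coords n b).toLinearMap ∘ₗ permOp V i j =
      permAct n N (Equiv.swap i j) ∘ₗ (coords n b).toLinearMap := by
    apply PiTensorProduct.ext
    ext x w
    simp only [LinearMap.compMultilinearMap_apply, LinearMap.comp_apply, LinearEquiv.coe_coe,
      permAct_apply, permOp, PiTensorProduct.reindex_tprod, coords_tprod, Equiv.symm_swap]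
    rw [← Equiv.prod_comp (Equiv.swap i j)]
    exact Finset.prod_congr rfl fun k _ =>
      congrArg (fun l => b.repr (x l) (w (Equiv.swap i j k))) (Equiv.swap_apply_self i j k)
  exact congrArg (fun f => f t) this

theorem coords_onFactor (i : Fin n) (a c : Fin N) (t : TPow n V) :
    coords n b (onFactor i (Matrix.toLin b b (Matrix.single a c 1)) t) =
      slot i a c (coords n b t) := by
  have : (coords n b).toLinearMap ∘ₗ onFactor i (Matrix.toLin b b (Matrix.single a c 1)) =
      slot i a c ∘ₗ (coords n b).toLinearMap := by
    apply PiTensorProduct.ext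
    ext x w
    simp only [LinearMap.compMultilinearMap_apply, LinearMap.comp_apply, LinearEquiv.coe_coe,
      slot_apply, onFactor_tprod, coords_tprod]
    have h1 : b.repr (Matrix.toLin b b (Matrix.single a c 1) (x i)) (w i) =
        if w i = a then b.repr (x i) c else 0 := by
      rw [Matrix.toLin_apply]
      simp [Matrix.single_mulVec, Finsupp.single_apply, Function.update_apply, eq_comm]
    rw [← Finset.mul_prod_erase Finset.univ _ (Finset.mem_univ i), Function.update_self, h1]
    split_ifs
    · rw [← Finset.mul_prod_erase Finset.univ (fun k => b.repr (x k) (Function.update w i c k))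
        (Finset.mem_univ i), Function.update_self]
      congr 1
      refine Finset.prod_congr rfl fun k hk => ?_
      rw [Function.update_of_ne (Finset.ne_of_mem_erase hk),
        Function.update_of_ne (Finset.ne_of_mem_erase hk)]
    · rw [zero_mul]
  exact congrArg (fun f => f t) this

/-- The action of the group algebra of the symmetric group on `V^{⊗ n}`. -/
def tensorRep : SymAlg n →ₐ[ℂ] Module.End ℂ (TPow n V) :=
  ((coords n b).symm.conjAlgEquiv ℂ).toAlgHom.comp (wordRep n N)

theorem coords_tensorRep (x : SymAlg n) (t : TPow n V) :
    coords n b (tensorRep b x t) = wordRep n N x (coords n b t) := by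
  simp [tensorRep, LinearEquiv.conjAlgEquiv]

theorem tensorRep_tr (i j : Fin n) : tensorRep b (tr i j) = permOp V i j := by
  refine LinearMap.ext fun t => (coords n b).injective ?_
  rw [coords_tensorRep, coords_permOp, tr, wordRep_of]

theorem ratMap_mul {A B : Type*} [Ring A] [Algebra ℂ A] [Ring B] [Algebra ℂ B] (f : A →ₐ[ℂ] B)
    (x y : RatFn n ⊗[ℂ] A) :
    ratMap f.toLinearMap (x * y) = ratMap f.toLinearMap x * ratMap f.toLinearMap y :=
  map_mul (Algebra.TensorProduct.map (AlgHom.id ℂ (RatFn n)) f) x y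

theorem ratMap_one {A B : Type*} [Ring A] [Algebra ℂ A] [Ring B] [Algebra ℂ B] (f : A →ₐ[ℂ] B) :
    ratMap (n := n) f.toLinearMap 1 = 1 :=
  map_one (Algebra.TensorProduct.map (AlgHom.id ℂ (RatFn n)) f)

theorem ratMap_symF : ratMap (tensorRep b).toLinearMap (symF n) = fusionF n V := by
  have hl (l : List (RatFn n ⊗[ℂ] SymAlg n)) : ratMap (tensorRep b).toLinearMap l.prod =
      (l.map (ratMap (tensorRep b).toLinearMap)).prod := by
    induction l with
    | nil => exact ratMap_one _
    | cons x l ih => rw [List.prod_cons, ratMap_mul, ih, List.map_cons, List.prod_cons]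
  rw [symF, hl, List.map_flatMap, fusionF]
  congr 2
  funext i
  rw [List.map_map]
  congr 1
  funext j
  rw [Function.comp_apply, map_sub, ratMap_one, ratMap_tmul, yangFactor]
  congr 2
  exact tensorRep_tr b i j

end Coordinates

/-! ### The image as a module over the enveloping algebra -/

section Modules

attribute [local instance] LieRing.ofAssociativeRing

variable {V : Type*} [AddCommGroup V] [Module ℂ V] {n N : ℕ}

theorem ugl_smul_def (u : Ugl V) (t : TPow n V) : u • t = chi V n u t := rfl

theorem algebraMap_smul_tensor (c : ℂ) (t : TPow n V) : algebraMap ℂ (Ugl V) c • t = c • t := by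
  rw [ugl_smul_def, AlgHom.commutes, Module.algebraMap_end_apply]

theorem envel_smul_tensor (g : Module.End ℂ V) (t : TPow n V) :
    envel g • t = ∑ i, onFactor i g t := by
  rw [ugl_smul_def, chi, UniversalEnvelopingAlgebra.lift_ι_apply]
  exact LinearMap.sum_apply _ _ _

variable (b : Module.Basis (Fin N) ℂ V)

theorem coords_matUnit_smul (a c : Fin N) (t : TPow n V) :
    coords n b (matUnit b a c • t) = low n a c (coords n b t) := by
  have h : below n n = Finset.univ := by ext i; simp [mem_below]
  rw [matUnit, envel_smul_tensor, map_sum, low, h, LinearMap.sum_apply]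
  exact Finset.sum_congr rfl fun i _ => coords_onFactor b i a c t

/-- Stability under the matrix units implies stability under the enveloping algebra. -/
theorem smul_mem_of_matUnit {S : Submodule ℂ (TPow n V)}
    (h : ∀ a c, ∀ t ∈ S, matUnit b a c • t ∈ S) (u : Ugl V) {t : TPow n V} (ht : t ∈ S) :
    u • t ∈ S := by
  induction u using Ugl.induction generalizing t with
  | h1 c => rw [algebraMap_smul_tensor]; exact S.smul_mem c ht
  | h2 g =>
    rw [envel_eq_sum b, Finset.sum_smul]
    refine Submodule.sum_mem _ fun i _ => ?_
    rw [Finset.sum_smul]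
    refine Submodule.sum_mem _ fun j _ => ?_
    rw [Algebra.smul_def, mul_smul, algebraMap_smul_tensor]
    exact S.smul_mem _ (h i j t ht)
  | h3 u u' hu hu' => rw [mul_smul]; exact hu (hu' ht)
  | h4 u u' hu hu' => rw [add_smul]; exact add_mem (hu ht) (hu' ht)

/-- The range of the fused operator on `V^{⊗ n}`. -/
def tensorRange (r : Fin n → ℕ) (M : ℕ) : Submodule ℂ (TPow n V) :=
  (fusedRange r M N n).comap (coords n b).toLinearMap

theorem mem_tensorRange {r : Fin n → ℕ} {M : ℕ} {t : TPow n V} :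
    t ∈ tensorRange b r M ↔ coords n b t ∈ fusedRange r M N n := Iff.rfl

theorem range_tensorRep_fused (r : Fin n → ℕ) (M : ℕ) :
    LinearMap.range (tensorRep b (fused r M n)) = tensorRange b r M := by
  ext t
  rw [mem_tensorRange, fusedRange, LinearMap.mem_range, LinearMap.mem_range]
  constructor
  · rintro ⟨s, rfl⟩
    exact ⟨coords n b s, (coords_tensorRep b _ s).symm⟩
  · rintro ⟨f, hf⟩
    refine ⟨(coords n b).symm f, (coords n b).injective ?_⟩
    rw [coords_tensorRep, LinearEquiv.apply_symm_apply, hf]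

/-- The range of the fused operator, as a module over the enveloping algebra. -/
def tensorModuleRange (r : Fin n → ℕ) (M : ℕ) : Submodule (Ugl V) (TPow n V) :=
  { (tensorRange b r M).toAddSubmonoid with
    smul_mem' := fun u _ ht => smul_mem_of_matUnit b (S := tensorRange b r M) (fun a c t ht => by
      rw [mem_tensorRange, coords_matUnit_smul]
      exact low_mem_fusedRange le_rfl a c ht) u ht }

theorem mem_tensorModuleRange {r : Fin n → ℕ} {M : ℕ} {t : TPow n V} :
    t ∈ tensorModuleRange b r M ↔ coords n b t ∈ fusedRange r M N n := Iff.rfl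

variable {r : Fin n → ℕ} {M : ℕ}

theorem fusedRange_ne_bot (hr : IsLattice r) (hn : n ≤ M) (hN : ∀ i, r i < N) (hNM : N ≤ M) :
    fusedRange r M N n ≠ ⊥ := by
  rw [fusedRange, Ne, LinearMap.range_eq_bot]
  exact wordRep_fused_ne_zero hr (fun i => (hN i).trans_le hNM) hn hN hNM

theorem isSimpleModule_tensorModuleRange (hr : IsLattice r) (hn : n ≤ M) (hN : ∀ i, r i < N)
    (hNM : N ≤ M) : IsSimpleModule (Ugl V) (tensorModuleRange b r M) := by
  have hM : ∀ i, r i < M := fun i => (hN i).trans_le hNM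
  rw [isSimpleModule_iff_isAtom]
  constructor
  · intro h
    obtain ⟨y, hy, hy0⟩ := Submodule.exists_mem_ne_zero_of_ne_bot (fusedRange_ne_bot hr hn hN hNM)
    have h1 : (coords n b).symm y ∈ tensorModuleRange b r M := by
      rwa [mem_tensorModuleRange, LinearEquiv.apply_symm_apply]
    rw [h, Submodule.mem_bot, LinearEquiv.map_eq_zero_iff] at h1
    exact hy0 h1
  · intro S hS
    by_contra h0
    let S' : Submodule ℂ (WordFn n N) :=
      { carrier := {y | (coords n b).symm y ∈ S}
        add_mem' := fun {x y} hx hy => by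
          rw [Set.mem_ofPred_eq, map_add]; exact add_mem hx hy
        zero_mem' := by rw [Set.mem_ofPred_eq, map_zero]; exact zero_mem _
        smul_mem' := fun c x hx => by
          rw [Set.mem_ofPred_eq, map_smul, ← algebraMap_smul_tensor]; exact S.smul_mem _ hx }
    have hmem {t : TPow n V} : coords n b t ∈ S' ↔ t ∈ S := by
      change (coords n b).symm (coords n b t) ∈ S ↔ _
      rw [LinearEquiv.symm_apply_apply]
    have hle : S' ≤ fusedRange r M N n := fun y hy => by
      have := hS.le hy
      rwa [mem_tensorModuleRange, LinearEquiv.apply_symm_apply] at this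
    have h0' : S' ≠ ⊥ := by
      obtain ⟨t, ht, ht0⟩ := Submodule.exists_mem_ne_zero_of_ne_bot h0
      intro h
      have h1 := hmem.mpr ht
      rw [h, Submodule.mem_bot, LinearEquiv.map_eq_zero_iff] at h1
      exact ht0 h1
    have heq := fusedRange_eq_of_le hr hM (nodalVanishing hr hM hn) hle h0' fun a c y hy => by
      obtain ⟨t, rfl⟩ := (coords n b).surjective y
      rw [← coords_matUnit_smul, hmem]
      exact S.smul_mem _ (hmem.mp hy)
    refine hS.not_ge fun t ht => ?_
    rw [mem_tensorModuleRange, ← heq, hmem] at ht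
    exact ht

theorem nonempty_tensorModuleRange_equiv (hr : IsLattice r) (hn : n ≤ M) (hN : ∀ i, r i < N)
    (hNM : N ≤ M) : Nonempty (tensorModuleRange b r M ≃ₗ[Ugl V]
      HighestWeightModule b fun i => (rowCount r n i : ℂ)) := by
  have hM : ∀ i, r i < M := fun i => (hN i).trans_le hNM
  have := isSimpleModule_tensorModuleRange b hr hn hN hNM
  obtain ⟨y, hy, hy0, hs⟩ := exists_isSing (k := n)
    (fun a c _ y hy => low_mem_fusedRange le_rfl a c hy) (fusedRange_ne_bot hr hn hN hNM)
  obtain ⟨t, rfl⟩ := (coords n b).surjective y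
  refine nonempty_equiv_highestWeightModule b _ (v := (⟨t, hy⟩ : tensorModuleRange b r M)) ?_ ?_ ?_
  · intro h
    have h1 : t = 0 := congrArg Subtype.val h
    exact hy0 (by rw [h1, map_zero])
  · intro i j hij
    refine Subtype.ext ((coords n b).injective ?_)
    change coords n b (matUnit b i j • t) = coords n b 0
    rw [coords_matUnit_smul, hs i j hij, map_zero]
  · intro i
    refine Subtype.ext ((coords n b).injective ?_)
    change coords n b (matUnit b i i • t) = coords n b (algebraMap ℂ (Ugl V) _ • t)
    rw [coords_matUnit_smul, algebraMap_smul_tensor, map_smul]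
    exact singWeight hr hM le_rfl (fun j _ => nodalVanishing hr hM hn j) _ hy hs i

theorem isConsecutiveEval_fusionF (hr : IsLattice r) (hM : ∀ i, r i < M) (hn : n ≤ M) :
    IsConsecutiveEval (fusionF n V) (rowContent r) (tensorRep b (fused r M n)) := by
  rw [← ratMap_symF b]
  exact (isConsecutiveEval_symF hr hM (nodalVanishing hr hM hn)).map (tensorRep b).toLinearMap

end Modules

end FusedYang

end

theorem theorem5p3 {V : Type*} [AddCommGroup V] [Module ℂ V] {N n : ℕ}
    (b : Module.Basis (Fin N) ℂ V) (μ : YoungDiagram) (hμ : μ.colLen 0 ≤ N)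
    (T : FusedYang.StandardYoungTableau n μ) :
    (∃! X : Module.End ℂ (FusedYang.TPow n V),
      FusedYang.IsConsecutiveEval (FusedYang.fusionF n V) T.content X) ∧
    ∀ X : Module.End ℂ (FusedYang.TPow n V),
      FusedYang.IsConsecutiveEval (FusedYang.fusionF n V) T.content X →
      ∃ W : Submodule (FusedYang.Ugl V) (FusedYang.TPow n V),
        (W : Set (FusedYang.TPow n V)) = LinearMap.range X ∧
        IsSimpleModule (FusedYang.Ugl V) W ∧
        Nonempty (W ≃ₗ[FusedYang.Ugl V]
          FusedYang.HighestWeightModule b (fun i => (μ.rowLen i : ℂ))) := by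
  have hN : ∀ i, T.rowOf i < N := fun i => (T.rowOf_lt i).trans_le hμ
  -- The auxiliary number of letters is `M = N + n`: at least `n` for faithfulness of the group
  -- algebra action, and at least `N` for restriction to words in `N` letters.
  have hNM : N ≤ N + n := Nat.le_add_right N n
  have hn : n ≤ N + n := Nat.le_add_left n N
  have hX := FusedYang.isConsecutiveEval_fusionF b T.isLattice
    (fun i => (hN i).trans_le hNM) hn
  rw [← T.content_eq] at hX
  refine ⟨⟨_, hX, fun X h => h.unique hX⟩, fun X h => ?_⟩
  obtain rfl := h.unique hX
  refine ⟨FusedYang.tensorModuleRange b T.rowOf (N + n), ?_,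
    FusedYang.isSimpleModule_tensorModuleRange b T.isLattice hn hN hNM, ?_⟩
  · rw [FusedYang.range_tensorRep_fused]
    rfl
  · have := FusedYang.nonempty_tensorModuleRange_equiv b T.isLattice hn hN hNM
    have hw : (fun i : Fin N => (FusedYang.rowCount T.rowOf n i : ℂ)) =
        fun i : Fin N => (μ.rowLen i : ℂ) := funext fun i => by rw [T.rowCount_eq_rowLen]
    rwa [hw] at this
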